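/- Let $T:X\to X$ be a continuous self-map of a compact metric space, $d\ge 1$, and let $\varphi=(\varphi_1,\dots,\varphi_d)$ be continuous real functions on $X$. Let $\mathcal P(T)$ be the set of $T$-invariant Borel probability measures, $h(T,\mu)$ the Kolmogorov–Sinai entropy, $\mu(\varphi)=(\int\varphi_i\,d\mu)_i\in\mathbb R^d$, $\rho(\varphi)=\{\mu(\varphi):\mu\in\mathcal P(T)\}$ the rotation set, and $\mathsf h(z)=\sup\{h(T,\mu):\mu\in\mathcal P(T),\ \mu(\varphi)=z\}$, with $\sup\varnothing=-\infty$. Write $\operatorname{dom}\mathsf h$ for the set of $z$ with $\mathsf h(z)$ finite. Assume that $(T,\varphi)$ is a $C^\omega$ Legendre system, i.e. $\rho(\varphi)$ has non-empty interior in $\mathbb R^d$, the topological entropy of $T$ is finite, and $\mathsf h$ is concave of $C^\omega$ Legendre type: it is upper semicontinuous and concave; $\operatorname{int}\operatorname{dom}\mathsf h\neq\varnothing$, and there $\mathsf h$ is strictly concave and real-analytic with everywhere negative definite Hessian; and $|\nabla\mathsf h(x_i)|\to+\infty$ for each sequence $x_i\in\operatorname{int}\operatorname{dom}\mathsf h$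 that converges to a boundary point of $\operatorname{dom}\mathsf h$. A linear equilibrium measure for $y\in\mathbb R^d$ is a $\mu\in\mathcal P(T)$ that maximizes $h(T,\mu)+\int\sum_i y_i\varphi_i\,d\mu$ over $\mathcal P(T)$. Let $\mathscr{EM}$ be one of the following sets of (nonlinear) equilibrium measures: (F) the set of maximizers over $\mathcal P(T)$ of $\mu\mapsto h(T,\mu)+F(\mu(\varphi))$, where $F$ is real-analytic on an open set $U\supset\rho(\varphi)$; (G) the set of maximizers over $\mathcal P(T)$ of $\mu\mapsto G\big(h(T,\mu);\mu(\varphi)\big)$, where $G$ is real-analytic on an open set $V\subset\mathbb R\times\mathbb R^d$, $\partial_0G>0$ on $V$ (derivative in the entropy variable), $V$ contains all points $(h(T,\mu);\mu(\varphi))$ with $\mu\in\mathcal P(T)$, and $V$ contains the closure of the graph $\{(\mathsf h(z);z):z\in\rho(\varphi)\}$. Let $\mathscr V=\{\mu(\varphi):\mu\in\mathscr{EM}\}$ be the set of equilibrium values. Then, in both cases: 1. If $d=1$ and for each $y\in\mathbb R$ there is exactly one linear equilibrium measure, then $\mathscr{EM}$ is finite. 2. For every $d\ge1$, the closure of $\mathscr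 V$ is a compact subset of a proper analytic subvariety of the open set $\operatorname{int}\rho(\varphi)\subset\mathbb R^d$, i.e. of a set $S\ne\operatorname{int}\rho(\varphi)$ that is the common zero set in $\operatorname{int}\rho(\varphi)$ of finitely many real-analytic functions on $\operatorname{int}\rho(\varphi)$; this closure is Lebesgue-null and has empty interior. If moreover for each $y\in\mathbb R^d$ there is at least one linear equilibrium measure (in particular if there is exactly one), then $\mathscr V$ itself is compact. -/

import Mathlib

open MeasureTheory Filter Topology
open scoped ContDiff

noncomputable section

namespace NonlinearThermo

/-- Euclidean `d`-space. -/
abbrev Euc (d : ℕ) : Type := EuclideanSpace ℝ (Fin d)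

section Entropy

variable {X : Type*} [MeasurableSpace X]

/-- The Shannon entropy `∑ -p log p` of the finite partition of `X` into the fibres of `P`. -/
def partitionEntropy {ι : Type*} [Fintype ι] (μ : Measure X) (P : X → ι) : ℝ :=
  ∑ i, Real.negMulLog (μ.real (P ⁻¹' {i}))

/-- The labelling of the refined partition `P ∨ T⁻¹P ∨ ⋯ ∨ T^{-(n-1)}P`: a point is sent to its
itinerary of length `n`. -/
def itinerary {ι : Type*} (T : X → X) (P : X → ι) (n : ℕ) : X → (Fin n → ι) :=
  fun x i => P (T^[(i : ℕ)] x)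

/-- The entropy rate of the partition `P` (the sequence converges for invariant `μ`). -/
def entropyRate {k : ℕ} (T : X → X) (μ : Measure X) (P : X → Fin k) : EReal :=
  limsup (fun n : ℕ => ((partitionEntropy μ (itinerary T P n) / n : ℝ) : EReal)) atTop

/-- The Kolmogorov–Sinai entropy `h(T, μ)`: supremum of the entropy rates of all finite measurable
partitions. -/
def ksEntropy (T : X → X) (μ : Measure X) : EReal :=
  ⨆ (k : ℕ) (P : X → Fin k) (_ : Measurable P), entropyRate T μ P

end Entropy

section LegendreType

variable {d : ℕ}

/-- The effective domain of an extended real valued function: the points with a finite value. -/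
def effDom (f : Euc d → EReal) : Set (Euc d) := {z | f z ≠ ⊥ ∧ f z ≠ ⊤}

/-- Concave functions of `C^r` Legendre type. Concavity is convexity of the hypograph; together
with `nonempty_interior` it forces `f < ⊤` everywhere. -/
structure IsConcaveLegendreType (r : WithTop ℕ∞) (f : Euc d → EReal) : Prop where
  upperSemicontinuous : UpperSemicontinuous f
  concave : Convex ℝ {p : Euc d × ℝ | (p.2 : EReal) ≤ f p.1}
  nonempty_interior : (interior (effDom f)).Nonempty
  strictConcaveOn : StrictConcaveOn ℝ (interior (effDom f)) (fun z => (f z).toReal)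
  contDiffOn : ContDiffOn ℝ r (fun z => (f z).toReal) (interior (effDom f))
  hessian_neg : 2 ≤ r → ∀ z ∈ interior (effDom f), ∀ v : Euc d, v ≠ 0 →
    iteratedFDeriv ℝ 2 (fun w => (f w).toReal) z (fun _ => v) < 0
  gradient_blowup : ∀ (x : ℕ → Euc d) (z : Euc d), (∀ i, x i ∈ interior (effDom f)) →
    z ∈ frontier (effDom f) → Tendsto x atTop (𝓝 z) →
    Tendsto (fun i => ‖gradient (fun w => (f w).toReal) (x i)‖) atTop atTop

/-- `S` is an analytic subvariety of the open set `W`: the common zero set in `W` of finitely many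
real-analytic functions on `W`. -/
def IsAnalyticSubvariety (W S : Set (Euc d)) : Prop :=
  ∃ (k : ℕ) (f : Fin k → Euc d → ℝ),
    (∀ i, AnalyticOnNhd ℝ (f i) W) ∧ S = {z ∈ W | ∀ i, f i z = 0}

end LegendreType

section Systems

variable {X : Type*} [MetricSpace X] [CompactSpace X] [MeasurableSpace X] [BorelSpace X] {d : ℕ}

/-- The `T`-invariant Borel probability measures. -/
def invMeasures (T : X → X) : Set (ProbabilityMeasure X) :=
  {μ | MeasurePreserving T (μ : Measure X) (μ : Measure X)}

/-- The vector `μ(φ) = (μ(φ₁), …, μ(φ_d))`. -/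
def mean (φ : Fin d → C(X, ℝ)) (μ : ProbabilityMeasure X) : Euc d :=
  WithLp.toLp 2 (fun i => ∫ x, φ i x ∂(μ : Measure X))

/-- The rotation set `ρ(φ)`. -/
def rotationSet (T : X → X) (φ : Fin d → C(X, ℝ)) : Set (Euc d) :=
  mean φ '' invMeasures T

/-- The finite-dimensional entropy function `z ↦ sup {h(T, μ) : μ(φ) = z}` (`⊥` off `ρ(φ)`). -/
def entropyFun (T : X → X) (φ : Fin d → C(X, ℝ)) (z : Euc d) : EReal :=
  ⨆ (μ : ProbabilityMeasure X) (_ : μ ∈ invMeasures T ∧ mean φ μ = z), ksEntropy T (μ : Measure X)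

/-- The graph of the entropy function over the rotation set, entropy coordinate first. -/
def entropyGraph (T : X → X) (φ : Fin d → C(X, ℝ)) : Set (ℝ × Euc d) :=
  (fun z => ((entropyFun T φ z).toReal, z)) '' rotationSet T φ

/-- `C^r` Legendre systems. -/
structure IsLegendreSystem (r : WithTop ℕ∞) (T : X → X) (φ : Fin d → C(X, ℝ)) : Prop where
  nonempty_interior : (interior (rotationSet T φ)).Nonempty
  topEntropy_finite : Dynamics.coverEntropy T Set.univ < ⊤
  legendreType : IsConcaveLegendreType r (entropyFun T φ)

/-- The linear equilibrium measures of the potential `y₁ φ₁ + ⋯ + y_d φ_d`. -/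
def linearEquilibria (T : X → X) (φ : Fin d → C(X, ℝ)) (y : Euc d) : Set (ProbabilityMeasure X) :=
  {μ ∈ invMeasures T | ∀ ν ∈ invMeasures T,
    ksEntropy T (ν : Measure X) + ((∫ x, ∑ i, y i * φ i x ∂(ν : Measure X) : ℝ) : EReal) ≤
      ksEntropy T (μ : Measure X) + ((∫ x, ∑ i, y i * φ i x ∂(μ : Measure X) : ℝ) : EReal)}

/-- The nonlinear equilibrium measures: maximizers of `h(T, μ) + F(μ(φ))`. -/
def nonlinearEquilibria (T : X → X) (φ : Fin d → C(X, ℝ)) (F : Euc d → ℝ) :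
    Set (ProbabilityMeasure X) :=
  {μ ∈ invMeasures T | ∀ ν ∈ invMeasures T,
    ksEntropy T (ν : Measure X) + (F (mean φ ν) : EReal) ≤
      ksEntropy T (μ : Measure X) + (F (mean φ μ) : EReal)}

/-- The point `(h(T, μ); μ(φ))` of the entropy-potential diagram. -/
def diagramPoint (T : X → X) (φ : Fin d → C(X, ℝ)) (μ : ProbabilityMeasure X) : ℝ × Euc d :=
  ((ksEntropy T (μ : Measure X)).toReal, mean φ μ)

/-- Admissible `C^r` functions `G : V → ℝ`. -/
structure IsAdmissible (r : WithTop ℕ∞) (T : X → X) (φ : Fin d → C(X, ℝ))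
    (V : Set (ℝ × Euc d)) (G : ℝ × Euc d → ℝ) : Prop where
  isOpen : IsOpen V
  contDiffOn : ContDiffOn ℝ r G V
  deriv_pos : ∀ p ∈ V, 0 < deriv (fun t => G (t, p.2)) p.1
  diagram_subset : ∀ μ ∈ invMeasures T, diagramPoint T φ μ ∈ V

/-- The fully nonlinear equilibrium measures: maximizers of `G(h(T, μ); μ(φ))`. -/
def fullyNonlinearEquilibria (T : X → X) (φ : Fin d → C(X, ℝ)) (G : ℝ × Euc d → ℝ) :
    Set (ProbabilityMeasure X) :=
  {μ ∈ invMeasures T | ∀ ν ∈ invMeasures T, G (diagramPoint T φ ν) ≤ G (diagramPoint T φ μ)}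

end Systems

end NonlinearThermo

end

open NonlinearThermo

/-! The problem on measures reduces to maximizing $g(z)=G(\mathsf h(z),z)$ over the rotation set
$K$. Since $\partial_0G>0$, a maximizing measure must have maximal entropy over its mean $z$, and
$z$ must maximize $g$ (`mem_fullyNonlinearEquilibria_iff`). The comparison needs the vertical
segment from a diagram point up to the graph to lie in $V$; it does because entropy takes all
intermediate values on a fibre of the mean (`exists_ksEntropy_mixMeasure_eq`).

Let $M$ be the set of maximum points of $g$. It is nonempty and compact although $\mathsf h$ is only
upper semicontinuous: maximize $G$ over the compact closure of the graph, where no maximum lies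
strictly below the graph. It avoids the boundary of $K$: there the gradient blow-up gives $\mathsf
h$ infinite slope towards the interior, and the entropy gain beats every first-order loss
(`graphMaximizers_subset_interior`). Inside, $g$ is analytic and $M$ is the zero set of $g-\max g$.
This function is not identically zero, since otherwise $M$ would be nonempty, compact and open in
$\mathbb R^d$. So $M$ is a compact proper analytic subvariety, hence null, and finite if $d=1$.

The equilibrium values lie in $M$. A linear equilibrium measure for $-\nabla\mathsf h(z)$ is the
same as a measure of maximal entropy over $z$: existence makes the set of values all of $M$, and
uniqueness puts only one equilibrium measure over each value. The case (F) is $G(s,z)=s+F(z)$. -/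

namespace NonlinearThermo

/-! ### Entropy along segments of measures -/

section Mixtures

variable {X : Type*} [MeasurableSpace X]

lemma negMulLog_add_le {a b : ℝ} (ha : 0 ≤ a) (hb : 0 ≤ b) :
    Real.negMulLog (a + b) ≤ Real.negMulLog a + Real.negMulLog b := by
  rcases ha.eq_or_lt with rfl | ha
  · simp
  rcases hb.eq_or_lt with rfl | hb
  · simp
  have h1 : Real.log a ≤ Real.log (a + b) := Real.log_le_log ha (by linarith)
  have h2 : Real.log b ≤ Real.log (a + b) := Real.log_le_log hb (by linarith)
  simp only [Real.negMulLog]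
  nlinarith

/-- The convex combination `s μ + (1 - s) ν`. -/
noncomputable def mixMeasure (μ ν : Measure X) (s : ℝ) : Measure X :=
  ENNReal.ofReal s • μ + ENNReal.ofReal (1 - s) • ν

@[simp] lemma mixMeasure_zero (μ ν : Measure X) : mixMeasure μ ν 0 = ν := by
  simp [mixMeasure]

@[simp] lemma mixMeasure_one (μ ν : Measure X) : mixMeasure μ ν 1 = μ := by
  simp [mixMeasure]

variable {μ ν : Measure X} {s : ℝ}

lemma isProbabilityMeasure_mixMeasure [IsProbabilityMeasure μ] [IsProbabilityMeasure ν]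
    (h0 : 0 ≤ s) (h1 : s ≤ 1) :
    IsProbabilityMeasure (mixMeasure μ ν s) := by
  constructor
  simp only [mixMeasure, Measure.coe_add, Measure.coe_smul, Pi.add_apply, Pi.smul_apply,
    measure_univ, smul_eq_mul, mul_one]
  rw [← ENNReal.ofReal_add h0 (by linarith)]
  simp

lemma mixMeasure_real [IsProbabilityMeasure μ] [IsProbabilityMeasure ν]
    (h0 : 0 ≤ s) (h1 : s ≤ 1) (A : Set X) :
    (mixMeasure μ ν s).real A = s * μ.real A + (1 - s) * ν.real A := by
  have h : ∀ (κ : Measure X) [IsProbabilityMeasure κ] (r : ℝ), (ENNReal.ofReal r • κ) A ≠ ⊤ :=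
    fun κ _ r => ENNReal.mul_ne_top ENNReal.ofReal_ne_top (measure_ne_top κ A)
  rw [mixMeasure, measureReal_add_apply (h μ s) (h ν (1 - s)), measureReal_ennreal_smul_apply,
    measureReal_ennreal_smul_apply, ENNReal.toReal_ofReal h0, ENNReal.toReal_ofReal (by linarith)]

lemma mixMeasure_mixMeasure [IsProbabilityMeasure μ] [IsProbabilityMeasure ν]
    {r t l : ℝ} (hr : r ∈ Set.Icc (0 : ℝ) 1) (ht : t ∈ Set.Icc (0 : ℝ) 1)
    (hl : l ∈ Set.Icc (0 : ℝ) 1) :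
    mixMeasure (mixMeasure μ ν r) (mixMeasure μ ν t) l = mixMeasure μ ν (l * r + (1 - l) * t) := by
  obtain ⟨hr0, hr1⟩ := hr
  obtain ⟨ht0, ht1⟩ := ht
  obtain ⟨hl0, hl1⟩ := hl
  have hl' : 0 ≤ 1 - l := by linarith
  have hr' : 0 ≤ 1 - r := by linarith
  have ht' : 0 ≤ 1 - t := by linarith
  have e1 : l * r + (1 - l) * t ∈ Set.Icc (0 : ℝ) 1 := ⟨by positivity, by nlinarith⟩
  have := isProbabilityMeasure_mixMeasure (μ := μ) (ν := ν) hr0 hr1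
  have := isProbabilityMeasure_mixMeasure (μ := μ) (ν := ν) ht0 ht1
  have := isProbabilityMeasure_mixMeasure (μ := μ) (ν := ν) e1.1 e1.2
  have := isProbabilityMeasure_mixMeasure (μ := mixMeasure μ ν r) (ν := mixMeasure μ ν t) hl0 hl1
  refine Measure.ext fun A _ => ?_
  rw [← measureReal_eq_measureReal_iff, mixMeasure_real hl0 hl1, mixMeasure_real hr0 hr1,
    mixMeasure_real ht0 ht1, mixMeasure_real e1.1 e1.2]
  ring

lemma measurePreserving_mixMeasure {T : X → X} (hμ : MeasurePreserving T μ μ)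
    (hν : MeasurePreserving T ν ν) :
    MeasurePreserving T (mixMeasure μ ν s) (mixMeasure μ ν s) := by
  refine ⟨hμ.measurable, ?_⟩
  rw [mixMeasure, Measure.map_add _ _ hμ.measurable, Measure.map_smul, Measure.map_smul,
    hμ.map_eq, hν.map_eq]

lemma partitionEntropy_nonneg [IsProbabilityMeasure μ]
    {ι : Type*} [Fintype ι] (Q : X → ι) : 0 ≤ partitionEntropy μ Q :=
  Finset.sum_nonneg fun _ _ => Real.negMulLog_nonneg measureReal_nonneg measureReal_le_one

lemma le_partitionEntropy_mixMeasure [IsProbabilityMeasure μ] [IsProbabilityMeasure ν]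
    (h0 : 0 ≤ s) (h1 : s ≤ 1) {ι : Type*} [Fintype ι]
    (Q : X → ι) :
    s * partitionEntropy μ Q + (1 - s) * partitionEntropy ν Q ≤
      partitionEntropy (mixMeasure μ ν s) Q := by
  simp only [partitionEntropy, Finset.mul_sum, ← Finset.sum_add_distrib]
  refine Finset.sum_le_sum fun i _ => ?_
  rw [mixMeasure_real h0 h1]
  exact Real.concaveOn_negMulLog.2 (x := μ.real (Q ⁻¹' {i})) (y := ν.real (Q ⁻¹' {i}))
    measureReal_nonneg measureReal_nonneg h0 (by linarith) (by ring)

lemma sum_measureReal_fiber [IsProbabilityMeasure μ] {ι : Type*} [Fintype ι] {Q : X → ι}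
    (hQ : ∀ i, MeasurableSet (Q ⁻¹' {i})) : ∑ i, μ.real (Q ⁻¹' {i}) = 1 := by
  have h := measureReal_biUnion_finset (μ := μ) (s := Finset.univ) (f := fun i => Q ⁻¹' {i})
    (fun i _ j _ hij => Disjoint.preimage Q (by simpa using hij)) (fun i _ => hQ i)
  rw [← h]
  have : (⋃ b ∈ (Finset.univ : Finset ι), Q ⁻¹' {b}) = Set.univ := by
    ext x; simp
  rw [this]
  exact probReal_univ

/-- Mixing adds at most the entropy of the coin $(s,1-s)$. This bound does not depend on the
partition, so it vanishes after division by $n$ in the entropy rate. -/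
lemma partitionEntropy_mixMeasure_le [IsProbabilityMeasure μ] [IsProbabilityMeasure ν]
    (h0 : 0 ≤ s) (h1 : s ≤ 1) {ι : Type*} [Fintype ι]
    {Q : X → ι} (hQ : ∀ i, MeasurableSet (Q ⁻¹' {i})) :
    partitionEntropy (mixMeasure μ ν s) Q ≤
      s * partitionEntropy μ Q + (1 - s) * partitionEntropy ν Q +
        (Real.negMulLog s + Real.negMulLog (1 - s)) := by
  have h1' : 0 ≤ 1 - s := by linarith
  have key : ∀ i, Real.negMulLog ((mixMeasure μ ν s).real (Q ⁻¹' {i})) ≤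
      s * Real.negMulLog (μ.real (Q ⁻¹' {i})) + (1 - s) * Real.negMulLog (ν.real (Q ⁻¹' {i})) +
      (μ.real (Q ⁻¹' {i}) * Real.negMulLog s + ν.real (Q ⁻¹' {i}) * Real.negMulLog (1 - s)) := by
    intro i
    rw [mixMeasure_real h0 h1]
    refine (negMulLog_add_le (mul_nonneg h0 measureReal_nonneg)
      (mul_nonneg h1' measureReal_nonneg)).trans ?_
    rw [Real.negMulLog_mul, Real.negMulLog_mul]
    linarith
  refine (Finset.sum_le_sum fun i _ => key i).trans ?_
  rw [Finset.sum_add_distrib, Finset.sum_add_distrib, Finset.sum_add_distrib, ← Finset.mul_sum,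
    ← Finset.mul_sum, ← Finset.sum_mul, ← Finset.sum_mul, sum_measureReal_fiber hQ,
    sum_measureReal_fiber hQ, one_mul, one_mul]
  rfl

lemma entropyRate_le_ksEntropy {T : X → X} {k : ℕ} {P : X → Fin k} (hP : Measurable P) :
    entropyRate T μ P ≤ ksEntropy T μ :=
  le_iSup_of_le k (le_iSup_of_le P (le_iSup_of_le hP le_rfl))

lemma ksEntropy_nonneg [IsProbabilityMeasure μ] (T : X → X) : 0 ≤ ksEntropy T μ := by
  refine le_trans ?_ (entropyRate_le_ksEntropy (μ := μ) (T := T)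
    (measurable_const (a := (0 : Fin 1))))
  refine Filter.le_limsup_of_frequently_le (Frequently.of_forall fun n => ?_)
  exact_mod_cast div_nonneg (partitionEntropy_nonneg _) (Nat.cast_nonneg n)

/-- Upper bounds on a limsup hold for all large $n$, so those for `μ` and `ν` can be combined at the
same $n$. -/
lemma ksEntropy_mixMeasure_le [IsProbabilityMeasure μ] [IsProbabilityMeasure ν]
    {T : X → X} (hT : Measurable T) (h0 : 0 ≤ s) (h1 : s ≤ 1) {a b : ℝ}
    (ha : ksEntropy T μ ≤ a) (hb : ksEntropy T ν ≤ b) :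
    ksEntropy T (mixMeasure μ ν s) ≤ ((s * a + (1 - s) * b : ℝ) : EReal) := by
  refine iSup_le fun k => iSup_le fun P => iSup_le fun hP => ?_
  refine EReal.le_of_forall_lt_iff_le.1 fun c hc => ?_
  have hc : s * a + (1 - s) * b < c := by exact_mod_cast hc
  set C := Real.negMulLog s + Real.negMulLog (1 - s)
  -- One `ε` absorbs the errors in the two entropy rates, the other the term `C / n`.
  set ε := (c - (s * a + (1 - s) * b)) / 2 with hε
  have hε0 : 0 < ε := by rw [hε]; linarith
  have ev : ∀ (κ : Measure X) (e : ℝ), ksEntropy T κ ≤ e → ∀ᶠ n : ℕ in atTop,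
      partitionEntropy κ (itinerary T P n) / n < e + ε := by
    intro κ e he
    have : entropyRate T κ P < ((e + ε : ℝ) : EReal) :=
      ((entropyRate_le_ksEntropy hP).trans he).trans_lt (by exact_mod_cast by linarith)
    filter_upwards [Filter.eventually_lt_of_limsup_lt this] with n hn
    exact_mod_cast hn
  have hC : ∀ᶠ n : ℕ in atTop, C / n < ε :=
    (tendsto_const_div_atTop_nhds_zero_nat C).eventually_lt_const hε0
  refine Filter.limsup_le_of_le (by isBoundedDefault) ?_
  filter_upwards [ev μ a ha, ev ν b hb, hC] with n h2 h3 h4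
  have hQ : ∀ i, MeasurableSet (itinerary T P n ⁻¹' {i}) := fun i =>
    (measurable_pi_lambda _ fun j => hP.comp (hT.iterate _)) (measurableSet_singleton i)
  have h5 := partitionEntropy_mixMeasure_le (μ := μ) (ν := ν) h0 h1 hQ
  have h6 : partitionEntropy (mixMeasure μ ν s) (itinerary T P n) / n ≤
      s * (partitionEntropy μ (itinerary T P n) / n) +
        (1 - s) * (partitionEntropy ν (itinerary T P n) / n) + C / n := by
    calc _ ≤ _ := div_le_div_of_nonneg_right h5 (Nat.cast_nonneg n)
      _ = _ := by ring
  have : partitionEntropy (mixMeasure μ ν s) (itinerary T P n) / n ≤ c := by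
    have := mul_le_mul_of_nonneg_left h2.le h0
    have := mul_le_mul_of_nonneg_left h3.le (sub_nonneg.2 h1)
    linarith
  exact_mod_cast this

/-- Lower bounds on a limsup hold only for infinitely many $n$, perhaps different ones for `μ` and
`ν`, so the contribution of `ν` is dropped as nonnegative. This weak bound suffices for continuity
at the ends of the segment. -/
lemma mul_le_ksEntropy_mixMeasure [IsProbabilityMeasure μ] [IsProbabilityMeasure ν]
    {T : X → X} (h0 : 0 ≤ s) (h1 : s ≤ 1) {c : ℝ}
    (hc : (c : EReal) < ksEntropy T μ) :
    ((s * c : ℝ) : EReal) ≤ ksEntropy T (mixMeasure μ ν s) := by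
  simp only [ksEntropy, lt_iSup_iff] at hc
  obtain ⟨k, P, hP, hc⟩ := hc
  refine le_trans ?_ (entropyRate_le_ksEntropy hP)
  refine Filter.le_limsup_of_frequently_le
    ((Filter.frequently_lt_of_lt_limsup (by isBoundedDefault) hc).mono fun n hn => ?_)
  have hn : c < partitionEntropy μ (itinerary T P n) / n := by exact_mod_cast hn
  have h5 := le_partitionEntropy_mixMeasure (μ := μ) (ν := ν) h0 h1 (itinerary T P n)
  have h6 : 0 ≤ (1 - s) * partitionEntropy ν (itinerary T P n) :=
    mul_nonneg (by linarith) (partitionEntropy_nonneg _)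
  have : s * c ≤ partitionEntropy (mixMeasure μ ν s) (itinerary T P n) / n :=
    calc s * c ≤ s * (partitionEntropy μ (itinerary T P n) / n) :=
          mul_le_mul_of_nonneg_left hn.le h0
      _ = s * partitionEntropy μ (itinerary T P n) / n := by ring
      _ ≤ _ := div_le_div_of_nonneg_right (by linarith) (Nat.cast_nonneg n)
  exact_mod_cast this

lemma mixMeasure_comm : mixMeasure μ ν s = mixMeasure ν μ (1 - s) := by
  simp [mixMeasure, add_comm]

/-- Entropy takes all intermediate values on a segment of measures. -/
lemma exists_ksEntropy_mixMeasure_eq [IsProbabilityMeasure μ] [IsProbabilityMeasure ν]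
    {T : X → X} (hT : Measurable T) {a b c : ℝ}
    (ha : ksEntropy T μ = a) (hb : ksEntropy T ν = b) (hc : c ∈ Set.Icc b a) :
    ∃ s ∈ Set.Icc (0 : ℝ) 1, ksEntropy T (mixMeasure μ ν s) = c := by
  set f : ℝ → ℝ := fun s => (ksEntropy T (mixMeasure μ ν s)).toReal with hf
  have hfin : ∀ s ∈ Set.Icc (0 : ℝ) 1, ((f s : ℝ) : EReal) = ksEntropy T (mixMeasure μ ν s) := by
    intro s hs
    have := isProbabilityMeasure_mixMeasure (μ := μ) (ν := ν) hs.1 hs.2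
    refine EReal.coe_toReal ?_ ?_
    · exact ((ksEntropy_mixMeasure_le hT hs.1 hs.2 ha.le hb.le).trans_lt (EReal.coe_lt_top _)).ne
    · exact ((EReal.bot_lt_zero).trans_le (ksEntropy_nonneg T)).ne'
  have hf0 : f 0 = b := by simp [hf, hb]
  have hf1 : f 1 = a := by simp [hf, ha]
  have hup : ∀ s ∈ Set.Icc (0 : ℝ) 1, f s ≤ s * a + (1 - s) * b := by
    intro s hs
    have := ksEntropy_mixMeasure_le hT hs.1 hs.2 ha.le hb.le
    rw [← hfin s hs] at this
    exact_mod_cast this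
  have hlow1 : ∀ s ∈ Set.Icc (0 : ℝ) 1, s * a ≤ f s := by
    intro s hs
    have h : ∀ c < a, s * c ≤ f s := by
      intro c hc
      have := mul_le_ksEntropy_mixMeasure (μ := μ) (ν := ν) (T := T) (c := c) hs.1 hs.2
        (by rw [ha]; exact_mod_cast hc)
      rw [← hfin s hs] at this
      exact_mod_cast this
    have ht : Tendsto (fun c => s * c) (𝓝[<] a) (𝓝 (s * a)) :=
      (Continuous.tendsto (by fun_prop) a).mono_left nhdsWithin_le_nhds
    exact le_of_tendsto ht (eventually_nhdsWithin_of_forall h)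
  have hlow0 : ∀ s ∈ Set.Icc (0 : ℝ) 1, (1 - s) * b ≤ f s := by
    intro s hs
    have h : ∀ c < b, (1 - s) * c ≤ f s := by
      intro c hc
      have := mul_le_ksEntropy_mixMeasure (μ := ν) (ν := μ) (T := T) (c := c) (s := 1 - s)
        (by linarith [hs.2]) (by linarith [hs.1]) (by rw [hb]; exact_mod_cast hc)
      rw [← mixMeasure_comm, ← hfin s hs] at this
      exact_mod_cast this
    have ht : Tendsto (fun c => (1 - s) * c) (𝓝[<] b) (𝓝 ((1 - s) * b)) :=
      (Continuous.tendsto (by fun_prop) b).mono_left nhdsWithin_le_nhds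
    exact le_of_tendsto ht (eventually_nhdsWithin_of_forall h)
  have hconv : ConvexOn ℝ (Set.Icc (0 : ℝ) 1) f := by
    refine ⟨convex_Icc 0 1, fun x hx y hy p q hp hq hpq => ?_⟩
    have := isProbabilityMeasure_mixMeasure (μ := μ) (ν := ν) hx.1 hx.2
    have := isProbabilityMeasure_mixMeasure (μ := μ) (ν := ν) hy.1 hy.2
    obtain rfl : q = 1 - p := by linarith
    have hp' : p ∈ Set.Icc (0 : ℝ) 1 := ⟨hp, by linarith⟩
    have h := ksEntropy_mixMeasure_le hT hp'.1 hp'.2 (hfin x hx).ge (hfin y hy).ge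
    rw [mixMeasure_mixMeasure hx hy hp',
      ← hfin (p * x + (1 - p) * y) (convex_Icc (0 : ℝ) 1 hx hy hp hq hpq)] at h
    exact_mod_cast h
  -- Convexity gives continuity inside; at each end `f` is squeezed between the chord and the
  -- one-measure lower bound.
  have hcont : ContinuousOn f (Set.Icc (0 : ℝ) 1) := by
    intro s hs
    rcases hs.1.eq_or_lt with rfl | h0
    · have h1 : Tendsto (fun s : ℝ => (1 - s) * b) (𝓝[Set.Icc 0 1] 0) (𝓝 b) :=
        ((Continuous.tendsto' (by fun_prop) 0 b (by simp))).mono_left nhdsWithin_le_nhds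
      have h2 : Tendsto (fun s : ℝ => s * a + (1 - s) * b) (𝓝[Set.Icc 0 1] 0) (𝓝 b) :=
        ((Continuous.tendsto' (by fun_prop) 0 b (by simp))).mono_left nhdsWithin_le_nhds
      rw [ContinuousWithinAt, hf0]
      exact tendsto_of_tendsto_of_tendsto_of_le_of_le' h1 h2
        (eventually_nhdsWithin_of_forall hlow0) (eventually_nhdsWithin_of_forall hup)
    rcases hs.2.eq_or_lt with rfl | h1
    · have h1 : Tendsto (fun s : ℝ => s * a) (𝓝[Set.Icc 0 1] 1) (𝓝 a) :=
        ((Continuous.tendsto' (by fun_prop) 1 a (by simp))).mono_left nhdsWithin_le_nhds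
      have h2 : Tendsto (fun s : ℝ => s * a + (1 - s) * b) (𝓝[Set.Icc 0 1] 1) (𝓝 a) :=
        ((Continuous.tendsto' (by fun_prop) 1 a (by simp))).mono_left nhdsWithin_le_nhds
      rw [ContinuousWithinAt, hf1]
      exact tendsto_of_tendsto_of_tendsto_of_le_of_le' h1 h2
        (eventually_nhdsWithin_of_forall hlow1) (eventually_nhdsWithin_of_forall hup)
    · have := hconv.continuousOn_interior
      rw [interior_Icc] at this
      exact (this.continuousAt (Ioo_mem_nhds h0 h1)).continuousWithinAt
  obtain ⟨s, hs, hsc⟩ := intermediate_value_Icc zero_le_one hcont (by rw [hf0, hf1]; exact hc)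
  exact ⟨s, hs, by rw [← hfin s hs, hsc]⟩

end Mixtures

end NonlinearThermo

namespace NonlinearThermo

/-! ### Concave functions on segments and at the boundary -/

section Concave

/-- Positivity of $\partial_0G$ compares two points of a vertical line only if the segment between
them stays in `V`; hence the later care about fibres. -/
lemma lt_of_deriv_pos_of_fiber_subset {E : Type*} [NormedAddCommGroup E]
    {V : Set (ℝ × E)} {G : ℝ × E → ℝ} (hG : ContinuousOn G V)
    (hpos : ∀ p ∈ V, 0 < deriv (fun t => G (t, p.2)) p.1) {a b : ℝ} {z : E} (hab : a < b)
    (hV : ∀ σ ∈ Set.Icc a b, (σ, z) ∈ V) : G (a, z) < G (b, z) := by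
  have hm : StrictMonoOn (fun t => G (t, z)) (Set.Icc a b) := by
    refine strictMonoOn_of_deriv_pos (convex_Icc a b) ?_ fun t ht => ?_
    · exact hG.comp (by fun_prop) hV
    · exact hpos (t, z) (hV t (interior_subset ht))
  exact hm ⟨le_rfl, hab.le⟩ ⟨hab.le, le_rfl⟩ hab

/-- Lying above the chord gives lower semicontinuity at the endpoints; the hypothesis supplies the
other half. -/
lemma continuousOn_Icc_of_concaveOn {g : ℝ → ℝ} (hg : ConcaveOn ℝ (Set.Icc 0 1) g)
    (hu : UpperSemicontinuousOn g (Set.Icc 0 1)) : ContinuousOn g (Set.Icc 0 1) := by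
  have m0 : (0 : ℝ) ∈ Set.Icc (0 : ℝ) 1 := ⟨le_rfl, zero_le_one⟩
  have m1 : (1 : ℝ) ∈ Set.Icc (0 : ℝ) 1 := ⟨zero_le_one, le_rfl⟩
  have hlow : ∀ t ∈ Set.Icc (0 : ℝ) 1, (1 - t) * g 0 + t * g 1 ≤ g t := by
    intro t ht
    simpa using hg.2 m0 m1 (sub_nonneg.2 ht.2) ht.1 (by ring)
  have hline : ∀ s, Tendsto (fun t : ℝ => (1 - t) * g 0 + t * g 1) (𝓝[Set.Icc 0 1] s)
      (𝓝 ((1 - s) * g 0 + s * g 1)) := fun s =>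
    (Continuous.tendsto (by fun_prop) s).mono_left nhdsWithin_le_nhds
  have hend : ∀ s ∈ Set.Icc (0 : ℝ) 1, g s = (1 - s) * g 0 + s * g 1 →
      ContinuousWithinAt g (Set.Icc 0 1) s := by
    intro s hs hgs
    refine tendsto_order.2 ⟨fun c hc => ?_, fun c hc => hu s hs c hc⟩
    rw [hgs] at hc
    filter_upwards [(hline s).eventually_const_lt hc, self_mem_nhdsWithin] with t h1 h2
    exact h1.trans_le (hlow t h2)
  intro s hs
  rcases hs.1.eq_or_lt with rfl | h0
  · exact hend 0 hs (by simp)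
  rcases hs.2.eq_or_lt with rfl | h1
  · exact hend 1 hs (by simp)
  have := hg.continuousOn_interior
  rw [interior_Icc] at this
  exact (this.continuousAt (Ioo_mem_nhds h0 h1)).continuousWithinAt

variable {E : Type*} [NormedAddCommGroup E] [InnerProductSpace ℝ E] {K : Set E} {f : E → ℝ}

lemma continuousOn_lineMap_of_concaveOn (hf : ConcaveOn ℝ K f) (hu : UpperSemicontinuousOn f K)
    {a b : E} (ha : a ∈ K) (hb : b ∈ K) :
    ContinuousOn (fun t : ℝ => f (AffineMap.lineMap a b t)) (Set.Icc 0 1) := by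
  have hmaps : Set.MapsTo (AffineMap.lineMap a b : ℝ → E) (Set.Icc 0 1) K := fun t ht =>
    hf.1.lineMap_mem ha hb ht
  refine continuousOn_Icc_of_concaveOn ?_ ?_
  · exact (hf.comp_affineMap (AffineMap.lineMap a b)).subset hmaps (convex_Icc 0 1)
  · exact hu.comp AffineMap.lineMap_continuous.continuousOn hmaps

lemma le_add_fderiv_of_concaveOn (hf : ConcaveOn ℝ K f) {x w : E} (hx : x ∈ K) (hw : w ∈ K)
    {f' : E →L[ℝ] ℝ} (hf' : HasFDerivAt f f' x) : f w ≤ f x + f' (w - x) := by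
  have h1 : HasDerivAt (fun t : ℝ => f (x + t • (w - x))) (f' (w - x)) 0 := by
    have h2 : HasDerivAt (fun t : ℝ => x + t • (w - x)) (w - x) 0 := by
      simpa using ((hasDerivAt_id (0 : ℝ)).smul_const (w - x)).const_add x
    exact HasFDerivAt.comp_hasDerivAt (f := fun t : ℝ => x + t • (w - x)) 0 (by simpa using hf') h2
  have h3 : Tendsto (fun t : ℝ => t⁻¹ • (f (x + t • (w - x)) - f x)) (𝓝[>] 0) (𝓝 (f' (w - x))) := by
    simpa using h1.tendsto_slope_zero_right
  have h4 : f w - f x ≤ f' (w - x) := by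
    refine ge_of_tendsto h3 ?_
    filter_upwards [Ioo_mem_nhdsGT (zero_lt_one' ℝ)] with t ht
    have h5 := hf.2 hx hw (sub_nonneg.2 ht.2.le) ht.1.le (by ring)
    have h6 : (1 - t) • x + t • w = x + t • (w - x) := by module
    rw [h6] at h5
    simp only [smul_eq_mul] at h5 ⊢
    rw [inv_mul_eq_div, le_div_iff₀ ht.1]
    linarith
  linarith

lemma lineMap_mem_interior (hK : Convex ℝ K) {z x : E} (hz : z ∈ K) (hx : x ∈ interior K) {t : ℝ}
    (h0 : 0 < t) (h1 : t ≤ 1) : (AffineMap.lineMap z x t : E) ∈ interior K := by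
  have := hK.combo_self_interior_mem_interior hz hx (sub_nonneg.2 h1) h0 (by ring)
  rwa [← AffineMap.lineMap_apply_module] at this

lemma tendsto_lineMap_nhdsGT (z x : E) :
    Tendsto (AffineMap.lineMap z x : ℝ → E) (𝓝[>] 0) (𝓝 z) := by
  have : Tendsto (AffineMap.lineMap z x : ℝ → E) (𝓝 0) (𝓝 z) :=
    (AffineMap.lineMap_continuous (p := z) (q := x)).tendsto' _ _ (by simp)
  exact this.mono_left nhdsWithin_le_nhds

variable [CompleteSpace E]

/-- At a boundary point where the gradient blows up, a bounded concave function has infinite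
one-sided slope towards the interior. -/
lemma eventually_slope_ge_of_gradient_blowup (hf : ConcaveOn ℝ K f) {C : ℝ}
    (hC : ∀ w ∈ K, |f w| ≤ C) (hd : DifferentiableOn ℝ f (interior K)) {z x : E} (hz : z ∈ K)
    (hx : x ∈ interior K)
    (hblow : Tendsto (fun w => ‖gradient f w‖) (𝓝[interior K] z) atTop) {L : ℝ} (hL : 0 ≤ L) :
    ∀ᶠ t : ℝ in 𝓝[>] 0, f z + t * L ≤ f (AffineMap.lineMap z x t) := by
  obtain ⟨r, hr, hball⟩ := Metric.isOpen_iff.1 isOpen_interior x hx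
  set ρ := r / 2
  have hρ : 0 < ρ := half_pos hr
  have ht : Tendsto (AffineMap.lineMap z x : ℝ → E) (𝓝[>] 0) (𝓝[interior K] z) := by
    refine tendsto_nhdsWithin_iff.2 ⟨tendsto_lineMap_nhdsGT z x, ?_⟩
    filter_upwards [Ioo_mem_nhdsGT (zero_lt_one' ℝ)] with t ht
    exact lineMap_mem_interior hf.1 hz hx ht.1 ht.2.le
  -- With this threshold `ρ * ‖p‖` exceeds `L` plus the oscillation bound `2 * C`; the `+ 1` makes
  -- `p` nonzero.
  have hev := (hblow.comp ht).eventually_ge_atTop ((L + 2 * C) / ρ + 1)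
  filter_upwards [hev, Ioo_mem_nhdsGT (zero_lt_one' ℝ)] with t h1 h2
  set y : E := AffineMap.lineMap z x t with hy
  have hyi : y ∈ interior K := lineMap_mem_interior hf.1 hz hx h2.1 h2.2.le
  set p := gradient f y with hp
  have hC0 : 0 ≤ C := (abs_nonneg _).trans (hC z hz)
  have h1 : (L + 2 * C) / ρ + 1 ≤ ‖p‖ := h1
  have hp0 : 0 < ‖p‖ := lt_of_lt_of_le (by positivity) h1
  have hp1 : L + 2 * C ≤ ρ * ‖p‖ := by
    have : (L + 2 * C) / ρ ≤ ‖p‖ := by linarith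
    rwa [div_le_iff₀' hρ] at this
  have hgrad : HasFDerivAt f (InnerProductSpace.toDual ℝ E p) y :=
    ((hd y hyi).differentiableAt (isOpen_interior.mem_nhds hyi)).hasGradientAt
  have hyK := interior_subset hyi
  have key : ∀ w ∈ K, f w ≤ f y + inner ℝ p (w - y) := fun w hw =>
    le_add_fderiv_of_concaveOn hf hyK hw hgrad
  -- Going against the gradient by `ρ` stays in `K`. The tangent bound at `w` then forces `(1 - t) *
  -- ⟨p, x - z⟩ ≥ ρ * ‖p‖ - 2 * C ≥ L`, and the tangent bound at `z` turns this into the slope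
  -- estimate.
  set w := x - (ρ / ‖p‖) • p with hw
  have hwK : w ∈ K := by
    refine interior_subset (hball ?_)
    rw [Metric.mem_ball, dist_eq_norm, hw, sub_sub_cancel_left, norm_neg, norm_smul,
      Real.norm_of_nonneg (by positivity), div_mul_cancel₀ _ hp0.ne']
    exact half_lt_self hr
  have hxy : x - y = (1 - t) • (x - z) := by
    rw [hy, AffineMap.lineMap_apply_module]; module
  have hzy : z - y = -(t • (x - z)) := by
    rw [hy, AffineMap.lineMap_apply_module]; module
  have k1 := key w hwK
  have e1 : w - y = (1 - t) • (x - z) - (ρ / ‖p‖) • p := by rw [← hxy, hw]; abel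
  rw [e1, inner_sub_right, inner_smul_right, inner_smul_right, real_inner_self_eq_norm_sq] at k1
  have e2 : ρ / ‖p‖ * ‖p‖ ^ 2 = ρ * ‖p‖ := by field_simp
  rw [e2] at k1
  have k2 := key z hz
  rw [hzy, inner_neg_right, inner_smul_right] at k2
  have a1 := abs_le.1 (hC w hwK)
  have a2 := abs_le.1 (hC y hyK)
  set q := inner ℝ p (x - z)
  have q1 : L ≤ (1 - t) * q := by linarith
  have q0 : 0 ≤ q := by
    by_contra hq
    have : (1 - t) * q < 0 := mul_neg_of_pos_of_neg (by linarith [h2.2]) (not_le.1 hq)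
    linarith
  have q2 : L ≤ q := by
    have := mul_nonneg h2.1.le q0
    linarith
  have := mul_le_mul_of_nonneg_left q2 h2.1.le
  linarith

end Concave

/-! ### Maximizing over the graph of a concave function -/

section Graph

variable {E : Type*} [NormedAddCommGroup E] [InnerProductSpace ℝ E] {K : Set E} {f : E → ℝ}

/-- The fibre of the closure of the graph of `f` over a point of `K` is an interval that
ends at the value of `f`. -/
lemma closure_graph_fiber (hf : ConcaveOn ℝ K f) (hu : UpperSemicontinuousOn f K)
    (hK : IsClosed K) {s : ℝ} {z : E} (h : (s, z) ∈ closure ((fun w => (f w, w)) '' K)) :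
    z ∈ K ∧ s ≤ f z ∧ ∀ σ ∈ Set.Icc s (f z), (σ, z) ∈ closure ((fun w => (f w, w)) '' K) := by
  have hzK : z ∈ K := by
    have h1 : Set.MapsTo Prod.snd ((fun w => (f w, w)) '' K) K := by
      rintro _ ⟨w, hw, rfl⟩; exact hw
    have := h1.closure continuous_snd h
    rwa [hK.closure_eq] at this
  have happ : ∀ ε > 0, ∃ w ∈ K, |f w - s| < ε ∧ dist w z < ε := by
    intro ε hε
    obtain ⟨_, ⟨w, hw, rfl⟩, hd⟩ := Metric.mem_closure_iff.1 h ε hε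
    rw [dist_comm, Prod.dist_eq, max_lt_iff, Real.dist_eq] at hd
    exact ⟨w, hw, hd⟩
  refine ⟨hzK, ?_, ?_⟩
  · by_contra hlt
    have hlt := not_le.1 hlt
    have hev := hu z hzK ((f z + s) / 2) (by linarith)
    obtain ⟨δ, hδ, hb⟩ := Metric.mem_nhdsWithin_iff.1 hev
    obtain ⟨w, hw, h1, h2⟩ := happ (min δ ((s - f z) / 2)) (lt_min hδ (by linarith))
    have h3 : f w < (f z + s) / 2 := hb ⟨h2.trans_le (min_le_left _ _), hw⟩
    have h4 := (abs_lt.1 (h1.trans_le (min_le_right _ _))).1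
    linarith
  · rintro σ ⟨h1, h2⟩
    rcases h1.eq_or_lt with rfl | h1
    · exact h
    rw [Metric.mem_closure_iff]
    intro ε hε
    -- Here `f w < σ ≤ f z`, and `f` is continuous along the segment from `w` to `z`, so it takes
    -- the value `σ` at a point no farther from `z` than `w`.
    obtain ⟨w, hw, h3, h4⟩ := happ (min ε (σ - s)) (lt_min hε (by linarith))
    have h5 := (abs_lt.1 (h3.trans_le (min_le_right _ _))).2
    have hcont := continuousOn_lineMap_of_concaveOn hf hu hw hzK
    obtain ⟨t, ht, hft⟩ := intermediate_value_Icc zero_le_one hcont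
      (show σ ∈ Set.Icc _ _ by simp only [AffineMap.lineMap_apply_zero,
        AffineMap.lineMap_apply_one]; constructor <;> linarith)
    refine ⟨_, ⟨AffineMap.lineMap w z t, hf.1.lineMap_mem hw hzK ht, rfl⟩, ?_⟩
    rw [dist_comm, Prod.dist_eq, max_lt_iff]
    constructor
    · simpa [hft] using hε
    · have h6 : dist (AffineMap.lineMap w z t) z ≤ dist w z := by
        rw [dist_lineMap_right, Real.norm_of_nonneg (sub_nonneg.2 ht.2)]
        exact mul_le_of_le_one_left dist_nonneg (by linarith [ht.1])
      exact (h6.trans_lt h4).trans_le (min_le_left _ _)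

variable {V : Set (ℝ × E)} {G : ℝ × E → ℝ}

/-- The maximum points of `z ↦ G (f z, z)` on `K`. -/
def graphMaximizers (K : Set E) (f : E → ℝ) (G : ℝ × E → ℝ) : Set E :=
  {z ∈ K | ∀ w ∈ K, G (f w, w) ≤ G (f z, z)}

/-- The closure of the graph is compact because `f` is bounded. A point of it below the graph is
beaten by the graph point above it, since the segment between them lies in the closure and so in
`V`. Hence the maximum points of `G` on the closure lie on the graph, and their projection is the
set sought. -/
lemma graphMaximizers_compact_nonempty (hf : ConcaveOn ℝ K f) (hu : UpperSemicontinuousOn f K)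
    (hK : IsCompact K) (hne : K.Nonempty) {C : ℝ} (hC : ∀ w ∈ K, |f w| ≤ C)
    (hG : ContinuousOn G V) (hpos : ∀ p ∈ V, 0 < deriv (fun t => G (t, p.2)) p.1)
    (hV : closure ((fun w => (f w, w)) '' K) ⊆ V) :
    IsCompact (graphMaximizers K f G) ∧ (graphMaximizers K f G).Nonempty := by
  set Γ := closure ((fun w => (f w, w)) '' K) with hΓ
  have hsub : ∀ w ∈ K, (f w, w) ∈ Γ := fun w hw => subset_closure ⟨w, hw, rfl⟩
  have hΓc : IsCompact Γ := by
    refine ((isCompact_Icc (a := -C) (b := C)).prod hK).closure_of_subset ?_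
    rintro _ ⟨w, hw, rfl⟩
    exact ⟨abs_le.1 (hC w hw), hw⟩
  have hΓne : Γ.Nonempty := hne.elim fun w hw => ⟨_, hsub w hw⟩
  obtain ⟨p, hp, hmax⟩ := hΓc.exists_isMaxOn hΓne (hG.mono hV)
  have hlift : ∀ s z, (s, z) ∈ Γ → z ∈ K ∧ (s = f z ∨ G (s, z) < G (f z, z)) := by
    intro s z h
    obtain ⟨h1, h2, h3⟩ := closure_graph_fiber hf hu hK.isClosed h
    refine ⟨h1, h2.eq_or_lt.imp_right fun h4 => ?_⟩
    exact lt_of_deriv_pos_of_fiber_subset hG hpos h4 fun σ hσ => hV (h3 σ hσ)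
  have htop : ∀ s z, (s, z) ∈ Γ → G p ≤ G (s, z) → s = f z := by
    intro s z h h1
    obtain ⟨h2, h3 | h3⟩ := hlift s z h
    · exact h3
    · exact absurd (hmax (hsub z h2)) (not_le.2 (h1.trans_lt h3))
  have heq : graphMaximizers K f G = Prod.snd '' (Γ ∩ {q | G p ≤ G q}) := by
    ext z
    constructor
    · rintro ⟨h1, h2⟩
      obtain ⟨s, z'⟩ := p
      have h3 := htop s z' hp le_rfl
      refine ⟨(f z, z), ⟨hsub z h1, ?_⟩, rfl⟩
      have := h2 z' (hlift s z' hp).1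
      rwa [← h3] at this
    · rintro ⟨⟨s, z'⟩, ⟨h1, h2⟩, rfl⟩
      have h3 := htop s z' h1 h2
      refine ⟨(hlift s z' h1).1, fun w hw => ?_⟩
      have h4 : G (f w, w) ≤ G p := hmax (hsub w hw)
      exact h4.trans (h3 ▸ h2)
  constructor
  · rw [heq]
    refine IsCompact.image ?_ continuous_snd
    refine hΓc.of_isClosed_subset ?_ Set.inter_subset_left
    exact (hG.mono hV).preimage_isClosed_of_isClosed isClosed_closure isClosed_Ici
  · rw [heq]
    exact ⟨p.2, p, ⟨hp, le_refl (G p)⟩, rfl⟩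

variable [CompleteSpace E]

/-- From a boundary point, a step `t` inwards raises `f` by at least `t * L` for any prescribed `L`,
while moving the base point costs `G` only $O(t)$. As $\partial_0G>0$, `G` increases. -/
lemma graphMaximizers_subset_interior (hf : ConcaveOn ℝ K f) (hu : UpperSemicontinuousOn f K)
    (hne : (interior K).Nonempty) {C : ℝ} (hC : ∀ w ∈ K, |f w| ≤ C)
    (hd : DifferentiableOn ℝ f (interior K))
    (hblow : ∀ z ∈ K \ interior K, Tendsto (fun w => ‖gradient f w‖) (𝓝[interior K] z) atTop)
    (hG : DifferentiableOn ℝ G V) (hVo : IsOpen V)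
    (hpos : ∀ p ∈ V, 0 < deriv (fun t => G (t, p.2)) p.1)
    (hV : (fun w => (f w, w)) '' K ⊆ V) :
    graphMaximizers K f G ⊆ interior K := by
  rintro z ⟨hz, hmax⟩
  by_contra hzi
  obtain ⟨x, hx⟩ := hne
  have hpV : (f z, z) ∈ V := hV ⟨z, hz, rfl⟩
  have hD := ((hG _ hpV).differentiableAt (hVo.mem_nhds hpV)).hasFDerivAt
  set D := fderiv ℝ G (f z, z)
  set a := D (1, 0) with ha
  have hapos : 0 < a := by
    have h1 : HasDerivAt (fun t : ℝ => (t, z)) ((1 : ℝ), (0 : E)) (f z) :=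
      (hasDerivAt_id _).prodMk (hasDerivAt_const _ _)
    have h2 := HasFDerivAt.comp_hasDerivAt (f := fun t : ℝ => (t, z)) (f z) hD h1
    have h3 : deriv (fun t => G (t, z)) (f z) = a := h2.deriv
    exact h3 ▸ hpos _ hpV
  set B := |D (0, x - z)|
  set N := ‖x - z‖
  -- Half of the gain `a * Δ` absorbs the `Δ` part of the linearization error. The other half is at
  -- least `a / 2 * (t * L)`, which covers the drift `t * B` and the rest `a / 2 * (t * N)` of the
  -- error, with `a / 2 * t` to spare.
  set L := 2 * B / a + N + 1 with hL
  have hL0 : 0 < L := by positivity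
  have hslope := eventually_slope_ge_of_gradient_blowup hf hC hd hz hx (hblow z ⟨hz, hzi⟩) hL0.le
  have htend : Tendsto (fun t : ℝ => ((f (AffineMap.lineMap z x t), AffineMap.lineMap z x t) :
      ℝ × E)) (𝓝[>] 0) (𝓝 (f z, z)) := by
    refine Tendsto.prodMk_nhds ?_ (tendsto_lineMap_nhdsGT z x)
    have := continuousOn_lineMap_of_concaveOn hf hu hz (interior_subset hx) 0
      ⟨le_rfl, zero_le_one⟩
    rw [ContinuousWithinAt, AffineMap.lineMap_apply_zero] at this
    refine this.mono_left ?_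
    rw [← nhdsWithin_Ioc_eq_nhdsGT (zero_lt_one' ℝ)]
    exact nhdsWithin_mono _ Set.Ioc_subset_Icc_self
  have hlittle := htend.eventually
    ((Asymptotics.isLittleO_iff.1 hD.isLittleO) (half_pos hapos))
  obtain ⟨t, h1, h2, h3⟩ := (hslope.and (hlittle.and (Ioo_mem_nhdsGT (zero_lt_one' ℝ)))).exists
  set y : E := AffineMap.lineMap z x t with hy
  have hyK : y ∈ K := hf.1.lineMap_mem hz (interior_subset hx) ⟨h3.1.le, h3.2.le⟩
  set Δ := f y - f z with hΔ
  have hΔL : t * L ≤ Δ := by rw [hΔ]; linarith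
  have ht := h3.1
  have hΔ0 : 0 < Δ := (mul_pos ht hL0).trans_le hΔL
  have hyz : y - z = t • (x - z) := by
    rw [hy, AffineMap.lineMap_apply_module]; module
  have e1 : ((f y, y) - (f z, z) : ℝ × E) = Δ • ((1 : ℝ), (0 : E)) + t • ((0 : ℝ), x - z) := by
    ext
    · simp [hΔ]
    · simp [hyz]
  have e2 : D ((f y, y) - (f z, z)) = Δ * a + t * D (0, x - z) := by
    rw [e1, map_add, map_smul, map_smul, smul_eq_mul, smul_eq_mul]
  have e3 : ‖((f y, y) - (f z, z) : ℝ × E)‖ ≤ Δ + t * N := by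
    rw [Prod.mk_sub_mk, Prod.norm_mk, hyz, norm_smul, Real.norm_of_nonneg ht.le,
      Real.norm_of_nonneg hΔ0.le]
    exact max_le (by nlinarith [norm_nonneg (x - z)]) (by linarith)
  have h5 : -(a / 2 * (Δ + t * N)) ≤ G (f y, y) - G (f z, z) - (Δ * a + t * D (0, x - z)) := by
    rw [← e2]
    exact neg_le_of_neg_le (((neg_le_abs _).trans h2).trans
      (mul_le_mul_of_nonneg_left e3 (half_pos hapos).le))
  have h6 := hmax y hyK
  have h7 : -(t * B) ≤ t * D (0, x - z) := by
    have := mul_le_mul_of_nonneg_left (neg_abs_le (D (0, x - z))) ht.le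
    linarith
  have h8 : a / 2 * (t * L) ≤ a / 2 * Δ := mul_le_mul_of_nonneg_left hΔL (half_pos hapos).le
  have h9 : a / 2 * (t * L) = t * B + a / 2 * (t * N) + a / 2 * t := by
    rw [hL]; field_simp
  have h10 : 0 < a / 2 * t := by positivity
  linarith

end Graph

end NonlinearThermo

namespace NonlinearThermo

/-! ### Zero sets of real-analytic functions -/

section AnalyticZeros

variable {E : Type*} [NormedAddCommGroup E] [NormedSpace ℝ E] {W : Set E} {f : E → ℝ}

lemma volume_zeros_on_segment_eq_zero (hf : AnalyticOnNhd ℝ f W) {y v : E}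
    (hy : ∀ t ∈ Set.Icc (0 : ℝ) 1, y + t • v ∈ W) (h1 : f (y + v) ≠ 0) :
    volume (Set.Icc (0 : ℝ) 1 ∩ {t | f (y + t • v) = 0}) = 0 := by
  have hg : AnalyticOnNhd ℝ (fun t : ℝ => f (y + t • v)) (Set.Icc 0 1) :=
    hf.comp (fun t _ => by fun_prop) hy
  rcases hg.eqOn_zero_or_eventually_ne_zero_of_preconnected isPreconnected_Icc with h | h
  · exact absurd (by simpa using h (show (1 : ℝ) ∈ Set.Icc 0 1 from ⟨zero_le_one, le_rfl⟩)) h1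
  · have := ae_restrict_le_codiscreteWithin (μ := volume) measurableSet_Icc h
    rw [mem_ae_iff] at this
    rw [Measure.restrict_apply₀' measurableSet_Icc.nullMeasurableSet] at this
    rw [Set.inter_comm]
    convert this using 2
    ext t; simp

/-- In dimension one a compact set of zeros of a nontrivial analytic function is finite. -/
theorem finite_zeros_of_finrank_eq_one (hE : Module.finrank ℝ E = 1)
    (hWc : IsPreconnected W) (hf : AnalyticOnNhd ℝ f W) (hne : ∃ w ∈ W, f w ≠ 0) {M : Set E}
    (hM : IsCompact M) (hMW : M ⊆ W) (hMf : ∀ z ∈ M, f z = 0) : M.Finite := by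
  by_contra hinf
  have : FiniteDimensional ℝ E := Module.finite_of_finrank_eq_succ hE
  let e : ℝ ≃L[ℝ] E := ContinuousLinearEquiv.ofFinrankEq (by simp [hE])
  have hinf' : (e ⁻¹' M).Infinite := by
    intro h
    refine hinf ?_
    rw [← Set.image_preimage_eq M e.surjective]
    exact h.image _
  have hcomp : IsCompact (e ⁻¹' M) := e.toHomeomorph.isCompact_preimage.2 hM
  have hconn : IsPreconnected (e ⁻¹' W) := e.toHomeomorph.isPreconnected_preimage.2 hWc
  obtain ⟨x, hx, hacc⟩ := hinf'.exists_accPt_of_subset_isCompact hcomp subset_rfl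
  have hg : AnalyticOnNhd ℝ (f ∘ e) (e ⁻¹' W) :=
    hf.comp (fun t _ => e.analyticAt t) (Set.mapsTo_preimage _ _)
  have h0 := hg.eqOn_zero_of_preconnected_of_frequently_eq_zero hconn (hMW hx)
    ((accPt_iff_frequently_nhdsNE.1 hacc).mono fun t ht => hMf _ ht)
  obtain ⟨w, hw, hfw⟩ := hne
  refine hfw ?_
  have := h0 (show e.symm w ∈ e ⁻¹' W by simpa using hw)
  simpa using this

variable [FiniteDimensional ℝ E] [MeasurableSpace E] [BorelSpace E]

/-- If the lines in the direction `v` through `A` meet `A` in null sets of parameters, then `A`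
is a null set. -/
lemma measure_eq_zero_of_forall_line (μ : Measure E) [μ.IsAddHaarMeasure] {A : Set E}
    (hA : MeasurableSet A) (v : E) {η : ℝ} (hη : 0 < η)
    (h : ∀ y, volume (Set.Icc (0 : ℝ) η ∩ {t | y + t • v ∈ A}) = 0) : μ A = 0 := by
  have hS : MeasurableSet {p : E × ℝ | p.1 + p.2 • v ∈ A} :=
    (by fun_prop : Measurable fun p : E × ℝ => p.1 + p.2 • v) hA
  -- Fubini: by hypothesis the slices at fixed `y` are null, whereas every slice at fixed `t` is a
  -- translate of `A`.
  have h1 : (μ.prod (volume.restrict (Set.Icc (0 : ℝ) η))) {p : E × ℝ | p.1 + p.2 • v ∈ A} = 0 := by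
    rw [Measure.measure_prod_null hS]
    refine Eventually.of_forall fun y => ?_
    simp only [Pi.zero_apply]
    rw [Measure.restrict_apply₀' measurableSet_Icc.nullMeasurableSet, Set.inter_comm]
    exact h y
  rw [Measure.prod_apply_symm hS] at h1
  have h2 : ∀ t : ℝ, μ ((fun y => (y, t)) ⁻¹' {p : E × ℝ | p.1 + p.2 • v ∈ A}) = μ A := fun t =>
    measure_preimage_add_right μ (t • v) A
  simp only [h2, lintegral_const, Measure.restrict_apply_univ, Real.volume_Icc, sub_zero] at h1
  exact (mul_eq_zero.1 h1).resolve_right (by simpa using hη)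

/-- The zero set of a nontrivial real-analytic function on a connected open set is null. -/
theorem measure_zeros_eq_zero_of_analyticOnNhd (μ : Measure E) [μ.IsAddHaarMeasure]
    (hW : IsOpen W) (hWc : IsPreconnected W) (hf : AnalyticOnNhd ℝ f W)
    (hne : ∃ w ∈ W, f w ≠ 0) : μ {z ∈ W | f z = 0} = 0 := by
  refine measure_null_of_locally_null _ fun z hz => ?_
  have hzW := hz.1
  obtain ⟨R, hR, hball⟩ := Metric.isOpen_iff.1 hW z hzW
  set r := R / 2 with hr
  have hr0 : 0 < r := half_pos hR
  obtain ⟨w, hw, hfw⟩ : ∃ w ∈ Metric.ball z r, f w ≠ 0 := by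
    by_contra! hcon
    obtain ⟨w, hw, hfw⟩ := hne
    refine hfw (hf.eqOn_zero_of_preconnected_of_eventuallyEq_zero hWc hzW ?_ hw)
    filter_upwards [Metric.ball_mem_nhds z hr0] with u hu using hcon u hu
  have hwW : w ∈ W := hball (Metric.ball_subset_ball (by linarith) hw)
  obtain ⟨δ₀, hδ₀, hnz⟩ := Metric.mem_nhds_iff.1
    ((hf w hwW).continuousAt.eventually_ne hfw)
  set δ := min δ₀ r
  have hδ : 0 < δ := lt_min hδ₀ hr0
  -- For `y` within `δ` of `z`, the point `y + v` is within `δ` of `w`, so `f` is nonzero at the end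
  -- of the segment from `y` to `y + v`.
  set v := w - z with hv
  have hvr : ‖v‖ < r := by rwa [hv, ← dist_eq_norm]
  -- Parameters up to `η` move a point by at most `δ / 2`, so a line piece that meets `A` starts
  -- within `δ` of `z`.
  set η := min 1 (δ / (2 * r)) with hη
  have hη0 : 0 < η := lt_min one_pos (by positivity)
  have hηv : η * ‖v‖ ≤ δ / 2 := by
    calc η * ‖v‖ ≤ δ / (2 * r) * r :=
          mul_le_mul (min_le_right _ _) hvr.le (norm_nonneg _) (by positivity)
      _ = δ / 2 := by field_simp
  set B := Metric.ball z (δ / 2) with hB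
  have hBW : B ⊆ W := (Metric.ball_subset_ball (by
    have := min_le_right δ₀ r
    linarith)).trans hball
  set A := {y ∈ B | f y = 0} with hAdef
  have hA : MeasurableSet A := by
    have h1 : IsOpen (B ∩ f ⁻¹' {0}ᶜ) :=
      (hf.continuousOn.mono hBW).isOpen_inter_preimage Metric.isOpen_ball isOpen_compl_singleton
    have h2 : A = B \ (B ∩ f ⁻¹' {0}ᶜ) := by
      ext y; simp [hAdef]
    rw [h2]
    exact measurableSet_ball.diff h1.measurableSet
  refine ⟨A, mem_nhdsWithin.2 ⟨B, Metric.isOpen_ball, Metric.mem_ball_self (by positivity),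
    fun y hy => ⟨hy.1, hy.2.2⟩⟩, ?_⟩
  refine measure_eq_zero_of_forall_line μ hA v hη0 fun y => ?_
  rcases Set.eq_empty_or_nonempty (Set.Icc (0 : ℝ) η ∩ {t | y + t • v ∈ A}) with he | ⟨t₀, ht₀, hA₀⟩
  · rw [he, measure_empty]
  have hyz : dist y z < δ := by
    have h1 : dist (y + t₀ • v) z < δ / 2 := hA₀.1
    have h2 : dist y (y + t₀ • v) ≤ η * ‖v‖ := by
      rw [dist_self_add_right, norm_smul, Real.norm_of_nonneg ht₀.1]
      exact mul_le_mul_of_nonneg_right ht₀.2 (norm_nonneg _)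
    linarith [dist_triangle y (y + t₀ • v) z]
  have hseg : ∀ t ∈ Set.Icc (0 : ℝ) 1, y + t • v ∈ W := by
    intro t ht
    refine hball ?_
    have h2 : dist (y + t • v) y ≤ ‖v‖ := by
      rw [dist_self_add_left, norm_smul, Real.norm_of_nonneg ht.1]
      exact mul_le_of_le_one_left (norm_nonneg _) ht.2
    have h3 := min_le_right δ₀ r
    rw [Metric.mem_ball]
    linarith [dist_triangle (y + t • v) y z]
  have h1 : f (y + v) ≠ 0 := by
    refine hnz (Metric.mem_ball.2 ?_)
    have : y + v - w = y - z := by rw [hv]; abel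
    rw [dist_eq_norm, this, ← dist_eq_norm]
    exact hyz.trans_le (min_le_left _ _)
  refine measure_mono_null ?_ (volume_zeros_on_segment_eq_zero hf hseg h1)
  exact fun t ht => ⟨⟨ht.1.1, ht.1.2.trans (min_le_left _ _)⟩, ht.2.2⟩

end AnalyticZeros

end NonlinearThermo

namespace NonlinearThermo

/-! ### Real-valued consequences of Legendre type -/

section LegendreTypeFacts

variable {d : ℕ} {r : WithTop ℕ∞} {f : Euc d → EReal}

/-- Prolong the segment from `z` through an interior point `x` to a point `y` of the domain. An
infinite value at `z` would, by concavity, make the value at `x` exceed any bound. -/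
lemma IsConcaveLegendreType.ne_top (hf : IsConcaveLegendreType r f) (z : Euc d) : f z ≠ ⊤ := by
  intro hz
  obtain ⟨x, hx⟩ := hf.nonempty_interior
  have htend : Tendsto (fun t : ℝ => x + t • (x - z)) (𝓝[>] 0) (𝓝 x) :=
    (Continuous.tendsto' (by fun_prop) 0 x (by simp)).mono_left nhdsWithin_le_nhds
  obtain ⟨t, hty, ht⟩ := ((htend.eventually (mem_interior_iff_mem_nhds.1 hx)).and
    self_mem_nhdsWithin).exists
  have ht : 0 < t := ht
  set y := x + t • (x - z) with hy
  have hfy : ((f y).toReal : EReal) = f y := EReal.coe_toReal hty.2 hty.1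
  have hxd := interior_subset hx
  have hfx : ((f x).toReal : EReal) = f x := EReal.coe_toReal hxd.2 hxd.1
  set M := ((1 + t) * (f x).toReal - (f y).toReal) / t + 1 with hM
  have h1 := hf.concave (x := (y, (f y).toReal)) (y := (z, M)) (a := 1 / (1 + t))
    (b := t / (1 + t)) (by simp [hfy]) (by simp [hz]) (by positivity) (by positivity)
    (by field_simp)
  have e1 : (1 / (1 + t)) • y + (t / (1 + t)) • z = x := by
    have e2 : (1 / (1 + t)) • y + (t / (1 + t)) • z = (1 / (1 + t)) • ((1 + t) • x) := by
      rw [hy]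
      have : t / (1 + t) = 1 / (1 + t) * t := by ring
      rw [this]; module
    rw [e2, smul_smul, one_div_mul_cancel (by positivity), one_smul]
  simp only [Prod.smul_mk, Prod.mk_add_mk, Set.mem_ofPred_eq, e1, smul_eq_mul] at h1
  rw [← hfx] at h1
  have h2 : 1 / (1 + t) * (f y).toReal + t / (1 + t) * M ≤ (f x).toReal := by exact_mod_cast h1
  have h3 : 1 / (1 + t) * (f y).toReal + t / (1 + t) * M = (f x).toReal + t / (1 + t) := by
    rw [hM]; field_simp; ring
  have h4 : 0 < t / (1 + t) := by positivity
  linarith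

lemma IsConcaveLegendreType.effDom_eq (hf : IsConcaveLegendreType r f) :
    effDom f = {z | f z ≠ ⊥} := by
  ext z; simp [effDom, hf.ne_top z]

lemma IsConcaveLegendreType.concaveOn_toReal (hf : IsConcaveLegendreType r f) :
    ConcaveOn ℝ (effDom f) (fun z => (f z).toReal) := by
  have key : ∀ x ∈ effDom f, ∀ y ∈ effDom f, ∀ a b : ℝ, 0 ≤ a → 0 ≤ b → a + b = 1 →
      ((a * (f x).toReal + b * (f y).toReal : ℝ) : EReal) ≤ f (a • x + b • y) := by
    intro x hx y hy a b ha hb hab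
    exact hf.concave (x := (x, (f x).toReal)) (y := (y, (f y).toReal))
      (EReal.coe_toReal hx.2 hx.1).le (EReal.coe_toReal hy.2 hy.1).le ha hb hab
  have hconv : Convex ℝ (effDom f) := by
    intro x hx y hy a b ha hb hab
    exact ⟨((EReal.bot_lt_coe _).trans_le (key x hx y hy a b ha hb hab)).ne', hf.ne_top _⟩
  refine ⟨hconv, fun x hx y hy a b ha hb hab => ?_⟩
  have h1 := key x hx y hy a b ha hb hab
  have h2 := hconv hx hy ha hb hab
  rw [← EReal.coe_toReal h2.2 h2.1] at h1
  exact_mod_cast h1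

lemma IsConcaveLegendreType.upperSemicontinuousOn_toReal (hf : IsConcaveLegendreType r f) :
    UpperSemicontinuousOn (fun z => (f z).toReal) (effDom f) := by
  intro z hz c hc
  have h1 : f z < (c : EReal) := by
    rw [← EReal.coe_toReal hz.2 hz.1]; exact_mod_cast hc
  filter_upwards [(hf.upperSemicontinuous z c h1).filter_mono nhdsWithin_le_nhds,
    self_mem_nhdsWithin] with w hw hwd
  rw [← EReal.coe_toReal hwd.2 hwd.1] at hw
  exact_mod_cast hw

lemma IsConcaveLegendreType.tendsto_norm_gradient (hf : IsConcaveLegendreType r f) {z : Euc d}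
    (hz : z ∈ frontier (effDom f)) :
    Tendsto (fun w => ‖gradient (fun w => (f w).toReal) w‖) (𝓝[interior (effDom f)] z) atTop := by
  refine tendsto_atTop.2 fun c => ?_
  by_contra hcon
  obtain ⟨x, hx, hxc⟩ := Filter.exists_seq_forall_of_frequently
    ((not_eventually.1 hcon).and_eventually self_mem_nhdsWithin)
  have h1 := hf.gradient_blowup x z (fun i => (hxc i).2) hz (hx.mono_right nhdsWithin_le_nhds)
  obtain ⟨i, hi⟩ := (h1.eventually_ge_atTop c).exists
  exact (hxc i).1 hi

lemma IsConcaveLegendreType.analyticOnNhd_toReal (hf : IsConcaveLegendreType ω f) :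
    AnalyticOnNhd ℝ (fun z => (f z).toReal) (interior (effDom f)) :=
  isOpen_interior.analyticOn_iff_analyticOnNhd.1
    ((contDiffOn_omega_iff_analyticOn isOpen_interior.uniqueDiffOn).1 hf.contDiffOn)

end LegendreTypeFacts

/-! ### The rotation set and its entropy function -/

section Systems

set_option linter.unusedSectionVars false

variable {X : Type*} [MetricSpace X] [CompactSpace X] [MeasurableSpace X] [BorelSpace X] {d : ℕ}
  {T : X → X} {φ : Fin d → C(X, ℝ)} {r : WithTop ℕ∞}

lemma ksEntropy_le_entropyFun {μ : ProbabilityMeasure X} (hμ : μ ∈ invMeasures T) :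
    ksEntropy T (μ : Measure X) ≤ entropyFun T φ (mean φ μ) :=
  le_iSup₂_of_le μ ⟨hμ, rfl⟩ le_rfl

lemma exists_lt_ksEntropy {z : Euc d} {c : EReal} (h : c < entropyFun T φ z) :
    ∃ μ ∈ invMeasures T, mean φ μ = z ∧ c < ksEntropy T (μ : Measure X) := by
  simp only [entropyFun, lt_iSup_iff] at h
  obtain ⟨μ, ⟨h1, h2⟩, h3⟩ := h
  exact ⟨μ, h1, h2, h3⟩

/-- Entropy is nonnegative. As a superlevel set of an upper semicontinuous function, the rotation
set is then closed. -/
lemma mem_rotationSet_iff {z : Euc d} : z ∈ rotationSet T φ ↔ 0 ≤ entropyFun T φ z := by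
  constructor
  · rintro ⟨μ, hμ, rfl⟩
    exact (ksEntropy_nonneg T).trans (ksEntropy_le_entropyFun hμ)
  · intro h
    obtain ⟨μ, hμ, hz, -⟩ := exists_lt_ksEntropy (EReal.bot_lt_zero.trans_le h)
    exact ⟨μ, hμ, hz⟩

lemma entropyFun_ne_bot_iff {z : Euc d} : entropyFun T φ z ≠ ⊥ ↔ z ∈ rotationSet T φ := by
  refine ⟨fun h => ?_, fun h => (EReal.bot_lt_zero.trans_le (mem_rotationSet_iff.1 h)).ne'⟩
  obtain ⟨μ, hμ, hz, -⟩ := exists_lt_ksEntropy (bot_lt_iff_ne_bot.2 h)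
  exact ⟨μ, hμ, hz⟩

lemma IsConcaveLegendreType.effDom_entropyFun (hL : IsConcaveLegendreType r (entropyFun T φ)) :
    effDom (entropyFun T φ) = rotationSet T φ := by
  rw [hL.effDom_eq]
  exact Set.ext fun z => entropyFun_ne_bot_iff

lemma isBounded_rotationSet : Bornology.IsBounded (rotationSet T φ) := by
  have h1 : IsCompact (WithLp.toLp 2 '' Set.pi Set.univ
      (fun i => Set.Icc (-‖φ i‖) ‖φ i‖) : Set (Euc d)) :=
    (isCompact_univ_pi fun i => isCompact_Icc).image (PiLp.continuous_toLp 2 _)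
  refine h1.isBounded.subset ?_
  rintro _ ⟨μ, -, rfl⟩
  refine ⟨_, fun i _ => ?_, rfl⟩
  have h2 : ‖∫ x, φ i x ∂(μ : Measure X)‖ ≤ ‖φ i‖ * (μ : Measure X).real Set.univ :=
    norm_integral_le_of_norm_le_const (Eventually.of_forall fun x => (φ i).norm_coe_le_norm x)
  rw [probReal_univ, mul_one] at h2
  exact abs_le.1 h2

lemma IsConcaveLegendreType.isCompact_rotationSet
    (hL : IsConcaveLegendreType r (entropyFun T φ)) : IsCompact (rotationSet T φ) := by
  refine Metric.isCompact_of_isClosed_isBounded ?_ isBounded_rotationSet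
  have : rotationSet T φ = entropyFun T φ ⁻¹' Set.Ici 0 := Set.ext fun z => mem_rotationSet_iff
  rw [this]
  exact hL.upperSemicontinuous.isClosed_preimage 0

lemma IsConcaveLegendreType.coe_toReal_entropyFun (hL : IsConcaveLegendreType r (entropyFun T φ))
    {z : Euc d} (hz : z ∈ rotationSet T φ) :
    ((entropyFun T φ z).toReal : EReal) = entropyFun T φ z :=
  EReal.coe_toReal (hL.ne_top z) (entropyFun_ne_bot_iff.2 hz)

lemma IsConcaveLegendreType.coe_toReal_ksEntropy (hL : IsConcaveLegendreType r (entropyFun T φ))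
    {μ : ProbabilityMeasure X} (hμ : μ ∈ invMeasures T) :
    ((ksEntropy T (μ : Measure X)).toReal : EReal) = ksEntropy T (μ : Measure X) := by
  refine EReal.coe_toReal ?_ ?_
  · exact ((ksEntropy_le_entropyFun hμ).trans_lt (lt_top_iff_ne_top.2 (hL.ne_top _))).ne
  · exact (EReal.bot_lt_zero.trans_le (ksEntropy_nonneg T)).ne'

lemma IsConcaveLegendreType.toReal_ksEntropy_le (hL : IsConcaveLegendreType r (entropyFun T φ))
    {μ : ProbabilityMeasure X} (hμ : μ ∈ invMeasures T) :
    (ksEntropy T (μ : Measure X)).toReal ≤ (entropyFun T φ (mean φ μ)).toReal := by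
  have h := ksEntropy_le_entropyFun (φ := φ) hμ
  rw [← hL.coe_toReal_ksEntropy hμ, ← hL.coe_toReal_entropyFun ⟨μ, hμ, rfl⟩] at h
  exact_mod_cast h

lemma IsConcaveLegendreType.exists_lt_toReal_ksEntropy
    (hL : IsConcaveLegendreType r (entropyFun T φ)) {z : Euc d} (hz : z ∈ rotationSet T φ) {c : ℝ}
    (hc : c < (entropyFun T φ z).toReal) :
    ∃ μ ∈ invMeasures T, mean φ μ = z ∧ c < (ksEntropy T (μ : Measure X)).toReal := by
  have h1 : (c : EReal) < entropyFun T φ z := by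
    rw [← hL.coe_toReal_entropyFun hz]; exact_mod_cast hc
  obtain ⟨μ, hμ, hm, h2⟩ := exists_lt_ksEntropy h1
  rw [← hL.coe_toReal_ksEntropy hμ] at h2
  exact ⟨μ, hμ, hm, by exact_mod_cast h2⟩

lemma IsConcaveLegendreType.exists_bound_entropyFun
    (hL : IsConcaveLegendreType r (entropyFun T φ)) :
    ∃ C, ∀ z ∈ rotationSet T φ, |(entropyFun T φ z).toReal| ≤ C := by
  have hu := hL.upperSemicontinuousOn_toReal
  rw [hL.effDom_entropyFun] at hu
  obtain ⟨C, hC⟩ := hu.bddAbove_of_isCompact hL.isCompact_rotationSet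
  refine ⟨C, fun z hz => ?_⟩
  rw [abs_of_nonneg (EReal.toReal_nonneg (mem_rotationSet_iff.1 hz))]
  exact hC ⟨z, hz, rfl⟩

lemma integral_linear_eq_inner_mean (y : Euc d) (μ : ProbabilityMeasure X) :
    ∫ x, ∑ i, y i * φ i x ∂(μ : Measure X) = inner ℝ y (mean φ μ) := by
  rw [integral_finsetSum]
  · simp only [mean, PiLp.inner_apply, integral_const_mul]
    exact Finset.sum_congr rfl fun i _ => mul_comm _ _
  · intro i _
    exact ((φ i).continuous.integrable_of_hasCompactSupport
      (HasCompactSupport.of_compactSpace _)).const_mul _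

/-- Every value between two entropies attained on a fibre of the mean is attained on that fibre. -/
lemma IsConcaveLegendreType.exists_toReal_ksEntropy_eq
    (hL : IsConcaveLegendreType r (entropyFun T φ)) {μ ν : ProbabilityMeasure X}
    (hμ : μ ∈ invMeasures T) (hν : ν ∈ invMeasures T) (hm : mean φ μ = mean φ ν) {c : ℝ}
    (hc : c ∈ Set.Icc (ksEntropy T (μ : Measure X)).toReal (ksEntropy T (ν : Measure X)).toReal) :
    ∃ κ ∈ invMeasures T, mean φ κ = mean φ μ ∧ (ksEntropy T (κ : Measure X)).toReal = c := by
  obtain ⟨s, hs, h⟩ := exists_ksEntropy_mixMeasure_eq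
    (MeasurePreserving.measurable (show MeasurePreserving T (μ : Measure X) (μ : Measure X) from hμ))
    (hL.coe_toReal_ksEntropy hν).symm (hL.coe_toReal_ksEntropy hμ).symm hc
  refine ⟨⟨mixMeasure ν μ s, isProbabilityMeasure_mixMeasure hs.1 hs.2⟩,
    measurePreserving_mixMeasure hν hμ, ?_, ?_⟩
  · refine congrArg (WithLp.toLp 2) (funext fun i => ?_)
    have hi : ∀ κ : ProbabilityMeasure X, Integrable (fun x => φ i x) (κ : Measure X) := fun κ =>
      (φ i).continuous.integrable_of_hasCompactSupport (HasCompactSupport.of_compactSpace _)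
    have h1 : ∫ x, φ i x ∂(ν : Measure X) = ∫ x, φ i x ∂(μ : Measure X) :=
      (congrArg (fun v : Euc d => v i) hm).symm
    change ∫ x, φ i x ∂(mixMeasure (ν : Measure X) (μ : Measure X) s) = _
    rw [mixMeasure, integral_add_measure ((hi ν).smul_measure ENNReal.ofReal_ne_top)
      ((hi μ).smul_measure ENNReal.ofReal_ne_top), integral_smul_measure, integral_smul_measure,
      h1, ENNReal.toReal_ofReal hs.1, ENNReal.toReal_ofReal (by linarith [hs.2]), ← add_smul]
    simp
  · change (ksEntropy T (mixMeasure (ν : Measure X) (μ : Measure X) s)).toReal = c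
    rw [h, EReal.toReal_coe]

end Systems

end NonlinearThermo

namespace NonlinearThermo

/-! ### Linear and nonlinear equilibrium measures -/

section Equilibria

set_option linter.unusedSectionVars false

variable {X : Type*} [MetricSpace X] [CompactSpace X] [MeasurableSpace X] [BorelSpace X] {d : ℕ}
  {T : X → X} {φ : Fin d → C(X, ℝ)}

lemma IsConcaveLegendreType.mem_linearEquilibria_iff {r : WithTop ℕ∞}
    (hL : IsConcaveLegendreType r (entropyFun T φ)) {y : Euc d} {μ : ProbabilityMeasure X} :
    μ ∈ linearEquilibria T φ y ↔ μ ∈ invMeasures T ∧ ∀ ν ∈ invMeasures T,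
      (ksEntropy T (ν : Measure X)).toReal + inner ℝ y (mean φ ν) ≤
        (ksEntropy T (μ : Measure X)).toReal + inner ℝ y (mean φ μ) := by
  refine and_congr_right fun hμ => forall₂_congr fun ν hν => ?_
  rw [integral_linear_eq_inner_mean, integral_linear_eq_inner_mean,
    ← hL.coe_toReal_ksEntropy hμ, ← hL.coe_toReal_ksEntropy hν]
  norm_cast

lemma IsConcaveLegendreType.entropyFun_le_tangent (hL : IsConcaveLegendreType ω (entropyFun T φ))
    {z w : Euc d} (hz : z ∈ interior (rotationSet T φ)) (hw : w ∈ rotationSet T φ) :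
    (entropyFun T φ w).toReal + inner ℝ (-gradient (fun u => (entropyFun T φ u).toReal) z) w ≤
      (entropyFun T φ z).toReal +
        inner ℝ (-gradient (fun u => (entropyFun T φ u).toReal) z) z := by
  have hconc := hL.concaveOn_toReal
  have hana := hL.analyticOnNhd_toReal
  rw [hL.effDom_entropyFun] at hconc hana
  have h := le_add_fderiv_of_concaveOn hconc (interior_subset hz) hw
    (hana z hz).differentiableAt.hasGradientAt.hasFDerivAt
  rw [InnerProductSpace.toDual_apply_apply, inner_sub_right] at h
  simp only [inner_neg_left]
  linarith

/-- The tangent inequality for the entropy function is strict off the point of contact. -/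
lemma IsConcaveLegendreType.eq_of_tangent_le (hL : IsConcaveLegendreType ω (entropyFun T φ))
    {z w : Euc d} (hz : z ∈ interior (rotationSet T φ)) (hw : w ∈ rotationSet T φ)
    (h : (entropyFun T φ z).toReal +
        inner ℝ (-gradient (fun u => (entropyFun T φ u).toReal) z) z ≤
      (entropyFun T φ w).toReal +
        inner ℝ (-gradient (fun u => (entropyFun T φ u).toReal) z) w) : w = z := by
  by_contra hne
  have hconc := hL.concaveOn_toReal
  have hstrict := hL.strictConcaveOn
  rw [hL.effDom_entropyFun] at hconc hstrict
  set g : Euc d → ℝ := fun u => (entropyFun T φ u).toReal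
  set p := -gradient g z
  -- Strict concavity is known only in the interior and `w` may be a boundary point. Contact with
  -- the tangent at `w` passes to the midpoint `u` of `w` and `z`, which is interior; strict
  -- concavity between `u` and `z` then gives the contradiction.
  have hmid : ∀ t : ℝ, 0 < t → t ≤ 1 →
      (AffineMap.lineMap w z t : Euc d) ∈ interior (rotationSet T φ) ∧
      g z + inner ℝ p z ≤ g (AffineMap.lineMap w z t) + inner ℝ p (AffineMap.lineMap w z t) := by
    intro t h0 h1
    refine ⟨lineMap_mem_interior hconc.1 hw hz h0 h1, ?_⟩
    have h2 := hconc.2 hw (interior_subset hz) (sub_nonneg.2 h1) h0.le (by ring)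
    have h4 : (1 - t) * (g z + inner ℝ p z) ≤ (1 - t) * (g w + inner ℝ p w) :=
      mul_le_mul_of_nonneg_left h (sub_nonneg.2 h1)
    change (1 - t) * g w + t * g z ≤ g _ at h2
    change (1 - t) * (g z + inner ℝ p z) ≤ (1 - t) * (g w + inner ℝ p w) at h4
    rw [AffineMap.lineMap_apply_module, inner_add_right, inner_smul_right, inner_smul_right]
    linarith
  obtain ⟨hu, hu'⟩ := hmid (1 / 2) (by norm_num) (by norm_num)
  set u : Euc d := AffineMap.lineMap w z (1 / 2 : ℝ) with hudef
  have huz : u ≠ z := by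
    intro h5
    rw [hudef, AffineMap.lineMap_eq_right_iff] at h5
    rcases h5 with h5 | h5
    · exact hne h5
    · norm_num at h5
  have h6 := hstrict.2 hu hz huz (by norm_num : (0 : ℝ) < 1 / 2) (by norm_num : (0 : ℝ) < 1 / 2)
    (by norm_num)
  have h7 := hL.entropyFun_le_tangent hz (hconc.1 (interior_subset hu) (interior_subset hz)
    (by norm_num : (0 : ℝ) ≤ 1 / 2) (by norm_num : (0 : ℝ) ≤ 1 / 2) (by norm_num))
  rw [inner_add_right, inner_smul_right, inner_smul_right] at h7
  change g _ + (1 / 2 * inner ℝ p u + 1 / 2 * inner ℝ p z) ≤ g z + inner ℝ p z at h7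
  change 1 / 2 * g u + 1 / 2 * g z < g _ at h6
  linarith

/-- Linear equilibrium measures of the conormal potential at an interior point `z` are exactly the
measures of maximal entropy over `z`. -/
lemma IsConcaveLegendreType.mem_linearEquilibria_neg_gradient_iff
    (hL : IsConcaveLegendreType ω (entropyFun T φ)) {z : Euc d}
    (hz : z ∈ interior (rotationSet T φ)) {μ : ProbabilityMeasure X} :
    μ ∈ linearEquilibria T φ (-gradient (fun u => (entropyFun T φ u).toReal) z) ↔
      μ ∈ invMeasures T ∧ mean φ μ = z ∧
        (ksEntropy T (μ : Measure X)).toReal = (entropyFun T φ z).toReal := by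
  rw [hL.mem_linearEquilibria_iff]
  refine and_congr_right fun hμ => ⟨fun h => ?_, ?_⟩
  · have h1 := hL.toReal_ksEntropy_le hμ
    have h2 : (entropyFun T φ z).toReal +
        inner ℝ (-gradient (fun u => (entropyFun T φ u).toReal) z) z ≤
        (ksEntropy T (μ : Measure X)).toReal +
        inner ℝ (-gradient (fun u => (entropyFun T φ u).toReal) z) (mean φ μ) := by
      -- The supremum over the fibre of `z` need not be attained, so `μ` is compared with measures
      -- of nearly maximal entropy.
      refine le_of_forall_lt fun c hc => ?_
      obtain ⟨ν, hν, hm, h3⟩ := hL.exists_lt_toReal_ksEntropy (interior_subset hz)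
        (sub_lt_iff_lt_add.2 hc)
      have h4 := h ν hν
      rw [hm] at h4
      linarith
    have h5 : mean φ μ = z := hL.eq_of_tangent_le hz ⟨μ, hμ, rfl⟩ (by linarith)
    rw [h5] at h1 h2
    exact ⟨h5, le_antisymm h1 (by linarith)⟩
  · rintro ⟨rfl, h⟩ ν hν
    rw [h]
    have h1 := hL.toReal_ksEntropy_le hν
    have h2 := hL.entropyFun_le_tangent hz (show mean φ ν ∈ rotationSet T φ from ⟨ν, hν, rfl⟩)
    linarith

variable {V : Set (ℝ × Euc d)} {G : ℝ × Euc d → ℝ}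

/-- The vertical segment lies in `V`: its top is a graph point, and all other points are diagram
points, by intermediate values of entropy on the fibre. -/
lemma IsAdmissible.diagramPoint_lt (hL : IsConcaveLegendreType ω (entropyFun T φ))
    (hG : IsAdmissible ω T φ V G) (hV : closure (entropyGraph T φ) ⊆ V)
    {μ : ProbabilityMeasure X} (hμ : μ ∈ invMeasures T)
    (h : (ksEntropy T (μ : Measure X)).toReal < (entropyFun T φ (mean φ μ)).toReal) :
    G (diagramPoint T φ μ) < G ((entropyFun T φ (mean φ μ)).toReal, mean φ μ) := by
  have hmem : mean φ μ ∈ rotationSet T φ := ⟨μ, hμ, rfl⟩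
  refine lt_of_deriv_pos_of_fiber_subset hG.contDiffOn.continuousOn hG.deriv_pos h fun σ hσ => ?_
  rcases hσ.2.eq_or_lt with rfl | hlt
  · exact hV (subset_closure ⟨_, hmem, rfl⟩)
  · obtain ⟨ν, hν, hm, hlt'⟩ := hL.exists_lt_toReal_ksEntropy hmem hlt
    obtain ⟨κ, hκ, hκm, rfl⟩ := hL.exists_toReal_ksEntropy_eq hμ hν hm.symm ⟨hσ.1, hlt'.le⟩
    have := hG.diagram_subset κ hκ
    rwa [diagramPoint, hκm] at this

lemma IsAdmissible.diagramPoint_le (hL : IsConcaveLegendreType ω (entropyFun T φ))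
    (hG : IsAdmissible ω T φ V G) (hV : closure (entropyGraph T φ) ⊆ V)
    {μ : ProbabilityMeasure X} (hμ : μ ∈ invMeasures T) :
    G (diagramPoint T φ μ) ≤ G ((entropyFun T φ (mean φ μ)).toReal, mean φ μ) := by
  rcases (hL.toReal_ksEntropy_le hμ).eq_or_lt with h | h
  · rw [diagramPoint, h]
  · exact (hG.diagramPoint_lt hL hV hμ h).le

/-- Nonlinear equilibrium measures are the measures of maximal entropy over the maximum points of
the nonlinear pressure on the graph of the entropy function. -/
lemma IsAdmissible.mem_fullyNonlinearEquilibria_iff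
    (hL : IsConcaveLegendreType ω (entropyFun T φ)) (hG : IsAdmissible ω T φ V G)
    (hV : closure (entropyGraph T φ) ⊆ V) {μ : ProbabilityMeasure X} :
    μ ∈ fullyNonlinearEquilibria T φ G ↔ μ ∈ invMeasures T ∧
      mean φ μ ∈ graphMaximizers (rotationSet T φ) (fun z => (entropyFun T φ z).toReal) G ∧
      (ksEntropy T (μ : Measure X)).toReal = (entropyFun T φ (mean φ μ)).toReal := by
  refine and_congr_right fun hμ => ⟨fun h => ?_, ?_⟩
  · have hmem : mean φ μ ∈ rotationSet T φ := ⟨μ, hμ, rfl⟩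
    have h1 : ∀ w ∈ rotationSet T φ, G ((entropyFun T φ w).toReal, w) ≤ G (diagramPoint T φ μ) := by
      intro w hw
      by_contra hcon
      have hcon := not_le.1 hcon
      have hpV : ((entropyFun T φ w).toReal, w) ∈ V := hV (subset_closure ⟨w, hw, rfl⟩)
      -- No measure need realize the graph point over `w`; continuity of `G` there lets a measure of
      -- nearly maximal entropy beat `μ` instead.
      have hc : ContinuousAt (fun s => G (s, w)) (entropyFun T φ w).toReal :=
        ContinuousAt.comp' (f := fun s : ℝ => (s, w))
          (hG.contDiffOn.continuousOn.continuousAt (hG.isOpen.mem_nhds hpV)) (by fun_prop)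
      obtain ⟨ε, hε, hball⟩ := Metric.mem_nhds_iff.1 (hc.eventually_const_lt hcon)
      obtain ⟨ν, hν, hm, h2⟩ := hL.exists_lt_toReal_ksEntropy hw
        (sub_lt_self (entropyFun T φ w).toReal hε)
      have h3 := hL.toReal_ksEntropy_le hν
      rw [hm] at h3
      have h4 : G (diagramPoint T φ μ) < G ((ksEntropy T (ν : Measure X)).toReal, w) := by
        refine hball (a := (ksEntropy T (ν : Measure X)).toReal) ?_
        rw [Metric.mem_ball, Real.dist_eq, abs_lt]
        exact ⟨by linarith, by linarith⟩
      have h5 := h ν hν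
      rw [diagramPoint, hm] at h5
      exact absurd h5 (not_le.2 h4)
    have h2 : (ksEntropy T (μ : Measure X)).toReal = (entropyFun T φ (mean φ μ)).toReal := by
      refine (hL.toReal_ksEntropy_le hμ).eq_or_lt.resolve_right fun hlt => ?_
      exact absurd (h1 _ hmem) (not_le.2 (hG.diagramPoint_lt hL hV hμ hlt))
    rw [diagramPoint, h2] at h1
    exact ⟨⟨hmem, h1⟩, h2⟩
  · rintro ⟨⟨-, h1⟩, h2⟩ ν hν
    refine (hG.diagramPoint_le hL hV hν).trans ?_
    rw [diagramPoint, h2]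
    exact h1 _ ⟨ν, hν, rfl⟩

/-- A compact set is not a nonempty open set in a noncompact connected space. -/
lemma ne_interior_of_isCompact {E : Type*} [TopologicalSpace E] [T2Space E] [PreconnectedSpace E]
    [NoncompactSpace E] {M K : Set E} (hM : IsCompact M) (hne : M.Nonempty) : M ≠ interior K := by
  intro h
  have : IsClopen M := ⟨hM.isClosed, h ▸ isOpen_interior⟩
  exact noncompact_univ E (this.eq_univ hne ▸ hM)

lemma IsAdmissible.graphMaximizers_properties (hd : 0 < d) (hL : IsLegendreSystem ω T φ)
    (hG : IsAdmissible ω T φ V G) (hV : closure (entropyGraph T φ) ⊆ V) :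
    ∃ g : Euc d → ℝ, AnalyticOnNhd ℝ g (interior (rotationSet T φ)) ∧
      (∃ w ∈ interior (rotationSet T φ), g w ≠ 0) ∧
      graphMaximizers (rotationSet T φ) (fun z => (entropyFun T φ z).toReal) G =
        {z ∈ interior (rotationSet T φ) | g z = 0} ∧
      IsCompact (graphMaximizers (rotationSet T φ) (fun z => (entropyFun T φ z).toReal) G) := by
  have hT := hL.legendreType
  obtain ⟨C, hC⟩ := hT.exists_bound_entropyFun
  have hK := hT.isCompact_rotationSet
  have hconc := hT.concaveOn_toReal
  have husc := hT.upperSemicontinuousOn_toReal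
  have hana := hT.analyticOnNhd_toReal
  have hblow := fun z => hT.tendsto_norm_gradient (z := z)
  rw [hT.effDom_entropyFun] at hconc husc hana hblow
  set f : Euc d → ℝ := fun z => (entropyFun T φ z).toReal
  have hGa : AnalyticOnNhd ℝ G V := hG.isOpen.analyticOn_iff_analyticOnNhd.1
    ((contDiffOn_omega_iff_analyticOn hG.isOpen.uniqueDiffOn).1 hG.contDiffOn)
  have hsub : ∀ z ∈ rotationSet T φ, (f z, z) ∈ V := fun z hz => hV (subset_closure ⟨z, hz, rfl⟩)
  obtain ⟨hMc, hMne⟩ := graphMaximizers_compact_nonempty hconc husc hK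
    (hL.nonempty_interior.mono interior_subset) hC hGa.continuousOn hG.deriv_pos hV
  have hMi : graphMaximizers (rotationSet T φ) f G ⊆ interior (rotationSet T φ) := by
    refine graphMaximizers_subset_interior hconc husc hL.nonempty_interior hC
      hana.differentiableOn (fun z hz => hblow z ?_) hGa.differentiableOn hG.isOpen hG.deriv_pos
      (subset_closure.trans hV)
    rwa [hK.isClosed.frontier_eq]
  obtain ⟨z₀, hz₀⟩ := hMne
  have hM : graphMaximizers (rotationSet T φ) f G =
      {z ∈ interior (rotationSet T φ) | G (f z, z) - G (f z₀, z₀) = 0} := by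
    ext z
    refine ⟨fun hz => ⟨hMi hz, sub_eq_zero.2 (le_antisymm (hz₀.2 z hz.1) (hz.2 z₀ hz₀.1))⟩, ?_⟩
    rintro ⟨hz, h⟩
    refine ⟨interior_subset hz, fun w hw => ?_⟩
    rw [sub_eq_zero.1 h]
    exact hz₀.2 w hw
  refine ⟨fun z => G (f z, z) - G (f z₀, z₀), ?_, ?_, hM, hMc⟩
  · refine AnalyticOnNhd.sub ?_ analyticOnNhd_const
    exact hGa.comp (hana.prod analyticOnNhd_id) fun z hz => hsub z (interior_subset hz)
  · by_contra! hcon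
    -- A positive dimension makes the space noncompact, so no nonempty compact set is open.
    have : NeZero d := ⟨hd.ne'⟩
    refine ne_interior_of_isCompact (K := rotationSet T φ) hMc ⟨z₀, hz₀⟩ ?_
    rw [hM]
    exact Set.Subset.antisymm (fun z hz => hz.1) fun z hz => ⟨hz, hcon z hz⟩

theorem IsAdmissible.equilibria_properties (hd : 0 < d) (hL : IsLegendreSystem ω T φ)
    (hG : IsAdmissible ω T φ V G) (hV : closure (entropyGraph T φ) ⊆ V) :
    (d = 1 → (∀ y, ∃! μ, μ ∈ linearEquilibria T φ y) →
      (fullyNonlinearEquilibria T φ G).Finite) ∧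
    ((∀ y, (linearEquilibria T φ y).Nonempty) →
      IsCompact (mean φ '' fullyNonlinearEquilibria T φ G)) ∧
    IsCompact (closure (mean φ '' fullyNonlinearEquilibria T φ G)) ∧
    (∃ S : Set (Euc d), IsAnalyticSubvariety (interior (rotationSet T φ)) S ∧
      S ≠ interior (rotationSet T φ) ∧
      closure (mean φ '' fullyNonlinearEquilibria T φ G) ⊆ S) ∧
    volume (closure (mean φ '' fullyNonlinearEquilibria T φ G)) = 0 ∧
    interior (closure (mean φ '' fullyNonlinearEquilibria T φ G)) = ∅ := by
  have hT := hL.legendreType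
  obtain ⟨g, hg, hne, hM, hMc⟩ := hG.graphMaximizers_properties hd hL hV
  have hconv := hT.concaveOn_toReal.1
  rw [hT.effDom_entropyFun] at hconv
  have hconn : IsPreconnected (interior (rotationSet T φ)) := hconv.interior.isPreconnected
  set M := graphMaximizers (rotationSet T φ) (fun z => (entropyFun T φ z).toReal) G
  have hMi : M ⊆ interior (rotationSet T φ) := fun z hz => (hM ▸ hz).1
  have hiff := fun μ => hG.mem_fullyNonlinearEquilibria_iff hT hV (μ := μ)
  have hsub : mean φ '' fullyNonlinearEquilibria T φ G ⊆ M := by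
    rintro _ ⟨μ, hμ, rfl⟩
    exact ((hiff μ).1 hμ).2.1
  have hcl : closure (mean φ '' fullyNonlinearEquilibria T φ G) ⊆ M :=
    closure_minimal hsub hMc.isClosed
  have hnull : volume (closure (mean φ '' fullyNonlinearEquilibria T φ G)) = 0 := by
    refine measure_mono_null hcl ?_
    rw [hM]
    exact measure_zeros_eq_zero_of_analyticOnNhd volume isOpen_interior hconn hg hne
  refine ⟨fun h1 huniq => ?_, fun hex => ?_, hMc.closure_of_subset hsub, ⟨M, ?_, ?_, hcl⟩, hnull,
    Measure.interior_eq_empty_of_null hnull⟩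
  · have hfin : M.Finite := finite_zeros_of_finrank_eq_one (by simp [h1]) hconn hg hne hMc hMi
      fun z hz => (hM ▸ hz).2
    -- The mean is injective on equilibrium measures: two with the same mean are linear equilibria
    -- for the same conormal potential.
    refine Set.Finite.of_finite_image (hfin.subset hsub) fun μ hμ ν hν hmn => ?_
    have hμ' := (hiff μ).1 hμ
    have hν' := (hiff ν).1 hν
    have hz := hMi hμ'.2.1
    refine (huniq _).unique ((hT.mem_linearEquilibria_neg_gradient_iff hz).2
      ⟨hμ'.1, rfl, hμ'.2.2⟩) ((hT.mem_linearEquilibria_neg_gradient_iff hz).2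
      ⟨hν'.1, hmn.symm, ?_⟩)
    rw [hmn]
    exact hν'.2.2
  · have heq : mean φ '' fullyNonlinearEquilibria T φ G = M := by
      refine hsub.antisymm fun z hz => ?_
      -- A linear equilibrium for the conormal direction attains the maximal entropy over `z`, so
      -- `z` is an equilibrium value.
      obtain ⟨μ, hμ⟩ := hex (-gradient (fun u => (entropyFun T φ u).toReal) z)
      obtain ⟨hμi, rfl, h⟩ := (hT.mem_linearEquilibria_neg_gradient_iff (hMi hz)).1 hμ
      exact ⟨μ, (hiff μ).2 ⟨hμi, hz, h⟩, rfl⟩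
    rwa [heq]
  · exact ⟨1, fun _ => g, fun _ => hg, by simpa using hM⟩
  · obtain ⟨w, hw, hgw⟩ := hne
    intro h
    rw [← h, hM] at hw
    exact hgw hw.2

/-- The nonlinear pressure `h(T, μ) + F(μ(φ))` is an admissible fully nonlinear one. -/
lemma isAdmissible_add {r : WithTop ℕ∞} {U : Set (Euc d)} {F : Euc d → ℝ}
    (hU : IsOpen U) (hsub : rotationSet T φ ⊆ U) (hF : ContDiffOn ℝ r F U) :
    IsAdmissible r T φ (Set.univ ×ˢ U) (fun p => p.1 + F p.2) where
  isOpen := isOpen_univ.prod hU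
  contDiffOn := contDiff_fst.contDiffOn.add
    (hF.comp contDiff_snd.contDiffOn fun _ hp => hp.2)
  deriv_pos p _ := by simp
  diagram_subset μ hμ := ⟨Set.mem_univ _, hsub ⟨μ, hμ, rfl⟩⟩

lemma IsConcaveLegendreType.nonlinearEquilibria_eq {r : WithTop ℕ∞}
    (hL : IsConcaveLegendreType r (entropyFun T φ)) (F : Euc d → ℝ) :
    nonlinearEquilibria T φ F = fullyNonlinearEquilibria T φ (fun p => p.1 + F p.2) := by
  ext μ
  refine and_congr_right fun hμ => forall₂_congr fun ν hν => ?_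
  rw [← hL.coe_toReal_ksEntropy hμ, ← hL.coe_toReal_ksEntropy hν]
  norm_cast

lemma IsConcaveLegendreType.closure_entropyGraph_subset {r : WithTop ℕ∞}
    (hL : IsConcaveLegendreType r (entropyFun T φ)) {U : Set (Euc d)}
    (hsub : rotationSet T φ ⊆ U) : closure (entropyGraph T φ) ⊆ Set.univ ×ˢ U := by
  have h : closure (entropyGraph T φ) ⊆ Set.univ ×ˢ rotationSet T φ := by
    refine closure_minimal ?_ (isClosed_univ.prod hL.isCompact_rotationSet.isClosed)
    rintro _ ⟨z, hz, rfl⟩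
    exact ⟨Set.mem_univ _, hz⟩
  exact h.trans (Set.prod_mono_right hsub)

end Equilibria

end NonlinearThermo

theorem theoremD {X : Type*} [MetricSpace X] [CompactSpace X] [MeasurableSpace X] [BorelSpace X]
    (T : X → X) (hT : Continuous T) (d : ℕ) (hd : 0 < d) (φ : Fin d → C(X, ℝ))
    (hL : IsLegendreSystem ω T φ) :
    -- nonlinearities `F`
    (∀ (U : Set (Euc d)) (F : Euc d → ℝ),
      IsOpen U → rotationSet T φ ⊆ U → ContDiffOn ℝ ω F U →
        (d = 1 → (∀ y, ∃! μ, μ ∈ linearEquilibria T φ y) →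
          (nonlinearEquilibria T φ F).Finite) ∧
        ((∀ y, (linearEquilibria T φ y).Nonempty) →
          IsCompact (mean φ '' nonlinearEquilibria T φ F)) ∧
        IsCompact (closure (mean φ '' nonlinearEquilibria T φ F)) ∧
        (∃ S : Set (Euc d), IsAnalyticSubvariety (interior (rotationSet T φ)) S ∧
          S ≠ interior (rotationSet T φ) ∧
          closure (mean φ '' nonlinearEquilibria T φ F) ⊆ S) ∧
        volume (closure (mean φ '' nonlinearEquilibria T φ F)) = 0 ∧
        interior (closure (mean φ '' nonlinearEquilibria T φ F)) = ∅) ∧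
    -- fully nonlinear pressures `G`
    (∀ (V : Set (ℝ × Euc d)) (G : ℝ × Euc d → ℝ),
      IsAdmissible ω T φ V G → closure (entropyGraph T φ) ⊆ V →
        (d = 1 → (∀ y, ∃! μ, μ ∈ linearEquilibria T φ y) →
          (fullyNonlinearEquilibria T φ G).Finite) ∧
        ((∀ y, (linearEquilibria T φ y).Nonempty) →
          IsCompact (mean φ '' fullyNonlinearEquilibria T φ G)) ∧
        IsCompact (closure (mean φ '' fullyNonlinearEquilibria T φ G)) ∧
        (∃ S : Set (Euc d), IsAnalyticSubvariety (interior (rotationSet T φ)) S ∧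
          S ≠ interior (rotationSet T φ) ∧
          closure (mean φ '' fullyNonlinearEquilibria T φ G) ⊆ S) ∧
        volume (closure (mean φ '' fullyNonlinearEquilibria T φ G)) = 0 ∧
        interior (closure (mean φ '' fullyNonlinearEquilibria T φ G)) = ∅) := by
  have h := hL.legendreType
  refine ⟨fun U F hU hsub hF => ?_, fun V G hG hV => hG.equilibria_properties hd hL hV⟩
  rw [h.nonlinearEquilibria_eq]
  exact (isAdmissible_add hU hsub hF).equilibria_properties hd hL
    (h.closure_entropyGraph_subset hsub)
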